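/- Identify closed curves with maps $\gamma:\mathbb{R}/\mathbb{Z}\to\mathbb{R}^2$. A $C^1$-immersion is *generic* if all its self-intersections are transverse double points. For a generic immersion $\gamma$ let $W(\gamma)$ be its winding number (the degree of the tangent $\gamma'/|\gamma'|$) and $J^+(\gamma),J^-(\gamma),\mathrm{St}(\gamma)$ Arnold's invariants. For $j_+,j_-,s,\omega\in\mathbb{Z}$ a *$(j_\pm,s,\omega)$-compartment* is a (non-empty) path component, with respect to regular homotopy ($C^1$-continuous paths of immersions), of the set of all generic immersions with $J^+=j_+$, $J^-=j_-$, $\mathrm{St}=s$, $W=\omega$. Let $S(\gamma)=\{(u,v): 0\le u<v<1,\ \gamma(u)=\gamma(v)\}=\{(u_1,v_1),\dots,(u_n,v_n)\}$, $T(\gamma)=\{u_1,v_1,\dots,u_n,v_n\}$, let $d_\gamma$ be the intrinsic distance along $\gamma$, and let $\Lambda(\gamma)=\min\{d_\gamma(a,b): a,b\in T(\gamma),\,a\ne b\}$ ($=\infty$ if $n=0$). For $\eta\in(0,1)$ let $\mathcal{F}(\eta,j_\pm,s,\omega)$ be the set of all generic immersions $\gamma\in C^1(\mathbb{R}/\mathbb{Z},\mathbb{R}^2)$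 with $|\gamma'|\equiv1$, $J^+(\gamma)=j_+$, $J^-(\gamma)=j_-$, $\mathrm{St}(\gamma)=s$, $W(\gamma)=\omega$ and $\Lambda(\gamma)\ge2\eta$ that are affine linear on $(u-\eta,u+\eta)$ for every $u\in T(\gamma)$. For $q>2$ and $\delta>0$ put $$\mathrm{TP}_{q,\delta}(\gamma)=\iint_{(\mathbb{R}/\mathbb{Z})^2\setminus Y_\delta(\gamma)}\left(\frac{2\,\mathrm{dist}(\ell(t),\gamma(s))}{|\gamma(t)-\gamma(s)|^2}\right)^q|\gamma'(s)||\gamma'(t)|\,ds\,dt\in[0,\infty],\qquad \ell(t)=\gamma(t)+\mathbb{R}\gamma'(t),$$ where $Y_\delta(\gamma)$ is the set of all $(x,y)$ such that, for some $i$, either $d_\gamma(x,u_i)<\delta$ and $d_\gamma(y,v_i)<\delta$, or $d_\gamma(x,v_i)<\delta$ and $d_\gamma(y,u_i)<\delta$. **Corollary 1.6.** Let $\mathcal{C}$ be a $(j_\pm,s,\omega)$-compartment, $q>2$ and $\eta\in(0,1)$. Let $\delta_k\in(0,\frac\eta2]$ with $\delta_k\to0$, let $\gamma_k$ minimize $\mathrm{TP}_{q,\delta_k}$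 in $\mathcal{F}(\eta,j_\pm,s,\omega)\cap\mathcal{C}$ for every $k$, and suppose that, after suitable translations, $\gamma_k+a_k\to\Gamma^\eta$ in $C^1(\mathbb{R}/\mathbb{Z},\mathbb{R}^2)$ with $a_k\in\mathbb{R}^2$. Then $$\mathrm{TP}_{q,\delta}(\Gamma^\eta)\le\mathrm{TP}_{q,\delta}(\gamma)$$ for every $\delta\in(0,\frac\eta2]$ and every $\gamma\in\mathcal{F}(\eta,j_\pm,s,\omega)\cap\mathcal{C}$ all of whose intersection angles (between the two tangent lines at a self-intersection) equal $\frac\pi2$. -/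

import Mathlib

open Filter Topology MeasureTheory Set
open scoped ENNReal

noncomputable section

namespace PlaneCurve

/-! The Euclidean plane is modelled by `ℂ` (as a real inner product space), and closed curves
`ℝ/ℤ → ℝ²` by `1`-periodic functions `ℝ → ℂ`. -/

/-- Closed plane curves of class `C¹`. -/
structure IsClosedC1 (γ : ℝ → ℂ) : Prop where
  periodic : Function.Periodic γ 1
  contDiff : ContDiff ℝ 1 γ

/-- Closed plane `C¹`-immersions (regular closed curves). -/
structure IsRegularClosed (γ : ℝ → ℂ) : Prop extends IsClosedC1 γ where
  deriv_ne_zero : ∀ t, deriv γ t ≠ 0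

/-- `S(γ)`: the pairs `u < v` of parameters in `ℝ/ℤ ≅ [0,1)` with `γ u = γ v`. -/
def selfInt (γ : ℝ → ℂ) : Set (ℝ × ℝ) :=
  {p | 0 ≤ p.1 ∧ p.1 < p.2 ∧ p.2 < 1 ∧ γ p.1 = γ p.2}

/-- The pair `p` of parameters of a self-intersection has multiplicity two: no further parameter in
`[0,1)` is mapped to the same point. -/
def IsDouble (γ : ℝ → ℂ) (p : ℝ × ℝ) : Prop :=
  ∀ t ∈ Ico (0 : ℝ) 1, γ t = γ p.1 → t = p.1 ∨ t = p.2

/-- The two tangent vectors at the parameters in `p` are not parallel. -/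
def IsTransverse (γ : ℝ → ℂ) (p : ℝ × ℝ) : Prop :=
  LinearIndependent ℝ ![deriv γ p.1, deriv γ p.2]

/-- Generic immersions: there are only finitely many self-intersections (which is automatic by
compactness), and all of them are transverse double points. -/
structure IsGeneric (γ : ℝ → ℂ) : Prop extends IsRegularClosed γ where
  finite : (selfInt γ).Finite
  transverse : ∀ p ∈ selfInt γ, IsTransverse γ p
  double : ∀ p ∈ selfInt γ, IsDouble γ p

/-- The winding number of `γ` is `ω`: the degree of the (normalised) tangent, computed by means of a
continuous angle function `θ` of `γ'`. -/
def HasWinding (γ : ℝ → ℂ) (ω : ℤ) : Prop :=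
  ∃ θ : ℝ → ℝ, Continuous θ ∧
    (∀ t, deriv γ t = (‖deriv γ t‖ : ℂ) * Complex.exp ((θ t : ℂ) * Complex.I)) ∧
    θ 1 - θ 0 = 2 * Real.pi * (ω : ℝ)

/-! ### Regular homotopies and the good part of the discriminant -/

/-- `h` restricted to `[0,1]` is a regular homotopy, that is, a path in the space of closed plane
immersions which is continuous with respect to the `C¹`-topology. -/
structure IsRegularHomotopy (h : ℝ → ℝ → ℂ) : Prop where
  regular : ∀ τ ∈ Icc (0 : ℝ) 1, IsRegularClosed (h τ)
  cont : ContinuousOn (fun p : ℝ × ℝ => h p.1 p.2) (Icc 0 1 ×ˢ univ)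
  cont_deriv : ContinuousOn (fun p : ℝ × ℝ => deriv (h p.1) p.2) (Icc 0 1 ×ˢ univ)

/-- `γ` is generic apart from exactly one self-intersection, which has multiplicity two and
satisfies `tangent (γ' u) (γ' v)`. -/
def IsSelfTangency (tangent : ℂ → ℂ → Prop) (γ : ℝ → ℂ) : Prop :=
  IsRegularClosed γ ∧ (selfInt γ).Finite ∧ (∀ p ∈ selfInt γ, IsDouble γ p) ∧
    ∃ p ∈ selfInt γ, tangent (deriv γ p.1) (deriv γ p.2) ∧
      ∀ p' ∈ selfInt γ, p' ≠ p → IsTransverse γ p'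

/-- `Δᵈ`: one direct self-tangency (tangent vectors in the same direction). -/
def DirectStratum : Set (ℝ → ℂ) :=
  {γ | IsSelfTangency (fun a b => ∃ c : ℝ, 0 < c ∧ b = c • a) γ}

/-- `Δⁱ`: one inverse self-tangency (tangent vectors in opposite directions). -/
def InverseStratum : Set (ℝ → ℂ) :=
  {γ | IsSelfTangency (fun a b => ∃ c : ℝ, c < 0 ∧ b = c • a) γ}

/-- `Δᵗ` with marked parameters: `γ` is generic apart from exactly one transverse triple point,
which is passed at the parameters `u < v < w` of `[0,1)`. -/
def IsTripleCurve (γ : ℝ → ℂ) (u v w : ℝ) : Prop :=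
  IsRegularClosed γ ∧ (selfInt γ).Finite ∧ (∀ p ∈ selfInt γ, IsTransverse γ p) ∧
    (u, v) ∈ selfInt γ ∧ (v, w) ∈ selfInt γ ∧
    (∀ t ∈ Ico (0 : ℝ) 1, γ t = γ u → t = u ∨ t = v ∨ t = w) ∧
    (∀ p ∈ selfInt γ, γ p.1 ≠ γ u → IsDouble γ p)

/-- The number of self-intersections. -/
def numSelfInt (γ : ℝ → ℂ) : ℤ := ((selfInt γ).ncard : ℤ)

/-- At time `τ₀` the number of self-intersections along `h` jumps by `2ε`. -/
def JumpsBy (h : ℝ → ℝ → ℂ) (τ₀ : ℝ) (ε : ℤ) : Prop :=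
  ∃ r > 0, ∀ a ∈ Ioo (τ₀ - r) τ₀, ∀ b ∈ Ioo τ₀ (τ₀ + r),
    numSelfInt (h b) - numSelfInt (h a) = 2 * ε

/-- Sign of a vanishing triangle. Near the parameters `u`, `v`, `w` the curve consists of three
branches 1, 2, 3 that intersect pairwise: branches 1 and 2 at the parameters `a₁₂`, `a₂₁`, branches
1 and 3 at `a₁₃`, `a₃₁`, and branches 2 and 3 at `a₂₃`, `a₃₂`. The cyclic order in which the curve
passes through the sides orients the triangle: side 1 from `P₁₃` to `P₁₂`, side 2 from `P₁₂` to
`P₂₃`, side 3 from `P₂₃` to `P₁₃`. The sign is `(-1) ^ k`, where `k` is the number of sides on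
which the direction of the curve agrees with this orientation, so that each side contributes `-1` if
the directions agree and `1` if not. -/
def TriangleSign (γ : ℝ → ℂ) (u v w r : ℝ) (ε : ℤ) : Prop :=
  ∃ a₁₂ ∈ Ioo (u - r) (u + r), ∃ a₁₃ ∈ Ioo (u - r) (u + r),
  ∃ a₂₁ ∈ Ioo (v - r) (v + r), ∃ a₂₃ ∈ Ioo (v - r) (v + r),
  ∃ a₃₁ ∈ Ioo (w - r) (w + r), ∃ a₃₂ ∈ Ioo (w - r) (w + r),
    γ a₁₂ = γ a₂₁ ∧ γ a₁₃ = γ a₃₁ ∧ γ a₂₃ = γ a₃₂ ∧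
    ε = (-(SignType.sign (a₁₂ - a₁₃) : ℤ)) * (-(SignType.sign (a₂₃ - a₂₁) : ℤ)) *
      (-(SignType.sign (a₃₁ - a₃₂) : ℤ))

/-- Transverse crossing of `Δᵈ` at time `τ₀` with sign `ε`; it is positive if the number of double
points increases. -/
def CrossesDirect (h : ℝ → ℝ → ℂ) (τ₀ : ℝ) (ε : ℤ) : Prop :=
  h τ₀ ∈ DirectStratum ∧ (ε = 1 ∨ ε = -1) ∧ JumpsBy h τ₀ ε

/-- Transverse crossing of `Δⁱ` at time `τ₀` with sign `ε`; it is positive if the number of double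
points increases. -/
def CrossesInverse (h : ℝ → ℝ → ℂ) (τ₀ : ℝ) (ε : ℤ) : Prop :=
  h τ₀ ∈ InverseStratum ∧ (ε = 1 ∨ ε = -1) ∧ JumpsBy h τ₀ ε

/-- Transverse crossing of `Δᵗ` at time `τ₀` with sign `ε`: the vanishing triangle has sign `-ε`
before and the newborn triangle has sign `ε` after the crossing. -/
def CrossesTriple (h : ℝ → ℝ → ℂ) (τ₀ : ℝ) (ε : ℤ) : Prop :=
  ∃ u v w : ℝ, IsTripleCurve (h τ₀) u v w ∧ (ε = 1 ∨ ε = -1) ∧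
    ∀ᶠ r in 𝓝[>] (0 : ℝ),
      (∀ᶠ τ in 𝓝[<] τ₀, TriangleSign (h τ) u v w r (-ε)) ∧
      (∀ᶠ τ in 𝓝[>] τ₀, TriangleSign (h τ) u v w r ε)

/-- Generic paths: regular homotopies that are generic except at finitely many times, namely the
times in `D`, `I`, `T`, at which they cross `Δᵈ`, `Δⁱ`, `Δᵗ`, respectively, transversely with the
sign given by `σ`. -/
structure IsGenericPath (h : ℝ → ℝ → ℂ) (D I T : Finset ℝ) (σ : ℝ → ℤ) : Prop where
  homotopy : IsRegularHomotopy h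
  generic : ∀ τ ∈ Icc (0 : ℝ) 1, τ ∉ D → τ ∉ I → τ ∉ T → IsGeneric (h τ)
  direct : ∀ τ ∈ D, τ ∈ Ioo (0 : ℝ) 1 ∧ CrossesDirect h τ (σ τ)
  inverse : ∀ τ ∈ I, τ ∈ Ioo (0 : ℝ) 1 ∧ CrossesInverse h τ (σ τ)
  triple : ∀ τ ∈ T, τ ∈ Ioo (0 : ℝ) 1 ∧ CrossesTriple h τ (σ τ)

/-! ### Arnold invariants -/

/-- For `k ≥ 0`, the standard curve of winding number `k + 1`: a counterclockwise circle with `k`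
small disjoint inner loops. -/
def loopCurve (k : ℕ) (t : ℝ) : ℂ :=
  Complex.exp (2 * Real.pi * t * Complex.I) +
    (2 / (2 * (k : ℂ) + 1)) * Complex.exp (2 * Real.pi * ((k : ℂ) + 1) * t * Complex.I)

/-- The figure-eight curve. -/
def figureEight (t : ℝ) : ℂ :=
  (Real.sin (2 * Real.pi * t) : ℂ) + (Real.sin (4 * Real.pi * t) : ℂ) * Complex.I

/-- Arnold's representative curve of winding number `ω`. -/
def repCurve (ω : ℤ) : ℝ → ℂ :=
  if ω = 0 then figureEight
  else if 0 < ω then loopCurve (ω.natAbs - 1)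
  else fun t => (starRingEnd ℂ) (loopCurve (ω.natAbs - 1) t)

/-- The prescribed value of `J⁺` on the representative curve of winding number `ω`. -/
def repJplus (ω : ℤ) : ℤ := if ω = 0 then 0 else -2 * (|ω| - 1)

/-- The prescribed value of `J⁻` on the representative curve of winding number `ω`. -/
def repJminus (ω : ℤ) : ℤ := if ω = 0 then -1 else -3 * (|ω| - 1)

/-- The prescribed value of `St` on the representative curve of winding number `ω`. -/
def repSt (ω : ℤ) : ℤ := if ω = 0 then 0 else |ω| - 1

/-- `W(γ) = ω`, `J⁺(γ) = jp`, `J⁻(γ) = jm` and `St(γ) = s`: there is a generic path from the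
representative curve of winding number `ω` to `γ` along which the invariants change from their
prescribed values to `jp`, `jm`, `s` according to Arnold's rules. -/
def HasInvariants (γ : ℝ → ℂ) (jp jm s ω : ℤ) : Prop :=
  HasWinding γ ω ∧
  ∃ (h : ℝ → ℝ → ℂ) (D I T : Finset ℝ) (σ : ℝ → ℤ),
    IsGenericPath h D I T σ ∧ h 0 = repCurve ω ∧ h 1 = γ ∧
    jp = repJplus ω + ∑ τ ∈ D, 2 * σ τ ∧
    jm = repJminus ω + ∑ τ ∈ I, (-2) * σ τ ∧
    s = repSt ω + ∑ τ ∈ T, σ τ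

/-- The set of all generic immersions with the given Arnold invariants and winding number. -/
def genericClass (jp jm s ω : ℤ) : Set (ℝ → ℂ) :=
  {γ | IsGeneric γ ∧ HasInvariants γ jp jm s ω}

/-- `C` is a (non-empty) `(jp, jm, s, ω)`-compartment: a path component, with respect to regular
homotopy, of the set of generic immersions with these invariants. -/
def IsCompartment (jp jm s ω : ℤ) (C : Set (ℝ → ℂ)) : Prop :=
  ∃ γ₀ ∈ genericClass jp jm s ω,
    C = {γ | ∃ h : ℝ → ℝ → ℂ, IsRegularHomotopy h ∧
      (∀ τ ∈ Icc (0 : ℝ) 1, h τ ∈ genericClass jp jm s ω) ∧ h 0 = γ₀ ∧ h 1 = γ}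

/-! ### Admissible curves and the truncated tangent-point energy -/

/-- `d_γ(x, y)`: the intrinsic distance along the closed curve `γ`, that is, the length of the
shorter arc between the parameters `x` and `y` of `ℝ/ℤ`. -/
def arcDist (γ : ℝ → ℂ) (x y : ℝ) : ℝ :=
  ⨅ k : ℤ, |∫ τ in x..(y + (k : ℝ)), ‖deriv γ τ‖|

/-- `T(γ)`: the parameters in `[0,1)` of the self-intersections. -/
def intParams (γ : ℝ → ℂ) : Set ℝ :=
  {a | ∃ p ∈ selfInt γ, a = p.1 ∨ a = p.2}

/-- `Λ(γ)`: the shortest intrinsic distance of distinct parameters in `T(γ)` (`∞` if `γ` has no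
self-intersections). -/
def minArcDist (γ : ℝ → ℂ) : ℝ≥0∞ :=
  ⨅ a ∈ intParams γ, ⨅ b ∈ intParams γ, ⨅ _ : a ≠ b, ENNReal.ofReal (arcDist γ a b)

/-- The class `F(η, j±, s, ω)`: generic immersions parametrized by arclength (hence of length one)
with the given invariants, with `Λ(γ) ≥ 2η`, and affine linear on `(u - η, u + η)` for every
`u ∈ T(γ)`. -/
def admissible (η : ℝ) (jp jm s ω : ℤ) : Set (ℝ → ℂ) :=
  {γ | γ ∈ genericClass jp jm s ω ∧ (∀ t, ‖deriv γ t‖ = 1) ∧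
    ENNReal.ofReal (2 * η) ≤ minArcDist γ ∧
    ∀ u ∈ intParams γ, ∃ p v : ℂ, ∀ x ∈ Ioo (u - η) (u + η), γ x = p + x • v}

/-- `Y_δ(γ)`, as a (doubly periodic) set of pairs of real parameters. -/
def truncSet (γ : ℝ → ℂ) (δ : ℝ) : Set (ℝ × ℝ) :=
  {z | ∃ p ∈ selfInt γ, (arcDist γ z.1 p.1 < δ ∧ arcDist γ z.2 p.2 < δ) ∨
    (arcDist γ z.1 p.2 < δ ∧ arcDist γ z.2 p.1 < δ)}

/-- The affine tangent line of `γ` at the parameter `t`. -/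
def tangentLine (γ : ℝ → ℂ) (t : ℝ) : Set ℂ := {z | ∃ c : ℝ, z = γ t + c • deriv γ t}

/-- The truncated tangent-point energy `TP_{q,δ}(γ)` with values in `[0,∞]`; the pair `z` stands for
the parameters `(s, t)`, and `2 dist(ℓ(t), γ(s)) / |γ(t) - γ(s)|²` is the inverse of the radius of the
circle through `γ(s)` and `γ(t)` that is tangent to the curve at `γ(t)`. -/
def truncEnergy (q δ : ℝ) (γ : ℝ → ℂ) : ℝ≥0∞ :=
  ∫⁻ z in (Ico (0 : ℝ) 1 ×ˢ Ico (0 : ℝ) 1) \ truncSet γ δ,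
    ENNReal.ofReal
      ((2 * Metric.infDist (γ z.1) (tangentLine γ z.2) / ‖γ z.2 - γ z.1‖ ^ 2) ^ q *
        (‖deriv γ z.1‖ * ‖deriv γ z.2‖))

/-- `γ` minimizes `TP_{q,δ}` in the class `A`. -/
def IsEnergyMinimizer (q δ : ℝ) (A : Set (ℝ → ℂ)) (γ : ℝ → ℂ) : Prop :=
  γ ∈ A ∧ ∀ β ∈ A, truncEnergy q δ γ ≤ truncEnergy q δ β

/-- The angle in `[0, π/2]` between the two tangent lines at the parameters in `p`. -/
def intersectionAngle (γ : ℝ → ℂ) (p : ℝ × ℝ) : ℝ :=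
  min (InnerProductGeometry.angle (deriv γ p.1) (deriv γ p.2))
    (Real.pi - InnerProductGeometry.angle (deriv γ p.1) (deriv γ p.2))

/-- Convergence of closed curves in `C¹(ℝ/ℤ, ℝ²)`. -/
def TendstoC1 (γ : ℕ → ℝ → ℂ) (Γ : ℝ → ℂ) : Prop :=
  IsClosedC1 Γ ∧ TendstoUniformly γ Γ atTop ∧
    TendstoUniformly (fun k => deriv (γ k)) (deriv Γ) atTop

end PlaneCurve

end

/-! Truncate the energy of an admissible curve at a small `δ'` instead of `δ`. The difference is the
energy of the parameter pairs in the annuli with radii `δ'` and `δ` around the crossings, and since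
the curve is straight there, each annulus contributes a quantity that depends only on the
intersection angle and is smallest at a right angle. All curves in a compartment have the same
number of crossings, so for a minimizer of `TP_{q,δ'}` and a competitor with right angles these
contributions can be cancelled: the minimizer also has the smaller `TP_{q,δ}`. Lower semicontinuity
carries this over to the limit of the minimizers, at the expense of an arbitrarily small change
of `δ`. -/

noncomputable section

namespace PlaneCurve

attribute [local instance] Complex.finrank_real_complex_fact

local notation "cross" => Complex.orientation.areaForm

/-! ### Crossings on the torus -/

/-- The projection `ℝ² → (ℝ/ℤ)²` from real parameters to points of the torus. -/
def toTorus : ℝ × ℝ → UnitAddCircle × UnitAddCircle := Prod.map (↑) (↑)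

/-- The self-intersections of a closed curve as pairs of distinct points of `ℝ/ℤ`. The pairs are
ordered, so that every double point counts twice; this makes `truncSet` a neighbourhood of the
crossings. -/
def crossings (γ : ℝ → ℂ) : Set (UnitAddCircle × UnitAddCircle) :=
  {P | P.1 ≠ P.2 ∧ ∃ z, toTorus z = P ∧ γ z.1 = γ z.2}

theorem isOpenQuotientMap_toTorus : IsOpenQuotientMap toTorus :=
  QuotientAddGroup.isOpenQuotientMap_mk.prodMap QuotientAddGroup.isOpenQuotientMap_mk

theorem map_toTorus_nhds (z : ℝ × ℝ) : map toTorus (𝓝 z) = 𝓝 (toTorus z) :=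
  isOpenQuotientMap_toTorus.isOpenMap.map_nhds_eq
    isOpenQuotientMap_toTorus.continuous.continuousAt

theorem apply_eq_of_coe_eq {E : Type*} {f : ℝ → E} (hf : Function.Periodic f 1) {u v : ℝ}
    (h : (u : UnitAddCircle) = v) : f u = f v := by
  rw [← hf.lift_coe u, ← hf.lift_coe v, h]

theorem exists_mem_Ico_coe_eq (x : UnitAddCircle) :
    ∃ u ∈ Ico (0 : ℝ) 1, (u : UnitAddCircle) = x := by
  simpa using AddCircle.eq_coe_Ico x

theorem injOn_coe_Ico : InjOn ((↑) : ℝ → UnitAddCircle) (Ico 0 1) := fun u hu v hv =>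
  (AddCircle.coe_eq_coe_iff_of_mem_Ico (p := (1 : ℝ)) (a := 0) (by simpa) (by simpa)).1

theorem periodic_deriv {E : Type*} [NormedAddCommGroup E] [NormedSpace ℝ E] {f : ℝ → E} {c : ℝ}
    (hf : Function.Periodic f c) : Function.Periodic (deriv f) c := fun t => by
  rw [← deriv_comp_add_const, funext hf]

section Crossings

variable {γ : ℝ → ℂ}

theorem toTorus_mem_crossings (hγ : Function.Periodic γ 1) {z : ℝ × ℝ} :
    toTorus z ∈ crossings γ ↔ (z.1 : UnitAddCircle) ≠ z.2 ∧ γ z.1 = γ z.2 := by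
  refine and_congr_right fun _ => ⟨?_, fun h => ⟨z, rfl, h⟩⟩
  rintro ⟨z', hz, h⟩
  obtain ⟨h1, h2⟩ := Prod.ext_iff.1 hz
  rwa [← apply_eq_of_coe_eq hγ h1, ← apply_eq_of_coe_eq hγ h2]

theorem toTorus_mem_crossings_of_mem_selfInt {p : ℝ × ℝ} (hp : p ∈ selfInt γ) :
    toTorus p ∈ crossings γ :=
  ⟨fun h => hp.2.1.ne (injOn_coe_Ico ⟨hp.1, hp.2.1.trans hp.2.2.1⟩
    ⟨hp.1.trans hp.2.1.le, hp.2.2.1⟩ h), p, rfl, hp.2.2.2⟩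

theorem swap_mem_crossings {P : UnitAddCircle × UnitAddCircle} (hP : P ∈ crossings γ) :
    P.swap ∈ crossings γ := by
  obtain ⟨hne, z, rfl, hz⟩ := hP
  exact ⟨hne.symm, z.swap, rfl, hz.symm⟩

theorem crossings_eq_image (hγ : Function.Periodic γ 1) :
    crossings γ = toTorus '' selfInt γ ∪ Prod.swap '' (toTorus '' selfInt γ) := by
  apply Subset.antisymm
  · rintro ⟨x, y⟩ hP
    obtain ⟨u, hu, rfl⟩ := exists_mem_Ico_coe_eq x
    obtain ⟨v, hv, rfl⟩ := exists_mem_Ico_coe_eq y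
    obtain ⟨hne, heq⟩ := (toTorus_mem_crossings hγ (z := (u, v))).1 hP
    rcases lt_or_gt_of_ne (ne_of_apply_ne _ hne) with h | h
    · exact Or.inl ⟨(u, v), ⟨hu.1, h, hv.2, heq⟩, rfl⟩
    · exact Or.inr ⟨_, ⟨(v, u), ⟨hv.1, h, hu.2, heq.symm⟩, rfl⟩, rfl⟩
  · rintro _ (⟨p, hp, rfl⟩ | ⟨_, ⟨p, hp, rfl⟩, rfl⟩)
    · exact toTorus_mem_crossings_of_mem_selfInt hp
    · exact swap_mem_crossings (toTorus_mem_crossings_of_mem_selfInt hp)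

theorem finite_crossings (hγ : Function.Periodic γ 1) (h : (selfInt γ).Finite) :
    (crossings γ).Finite := by
  rw [crossings_eq_image hγ]
  exact (h.image _).union ((h.image _).image _)

theorem forall_crossing_of_forall_selfInt (hγ : Function.Periodic γ 1)
    {R : UnitAddCircle × UnitAddCircle → Prop} (hswap : ∀ P, R P → R P.swap)
    (h : ∀ p ∈ selfInt γ, R (toTorus p)) {P : UnitAddCircle × UnitAddCircle}
    (hP : P ∈ crossings γ) : R P := by
  rw [crossings_eq_image hγ] at hP
  rcases hP with ⟨p, hp, rfl⟩ | ⟨_, ⟨p, hp, rfl⟩, rfl⟩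
  · exact h p hp
  · exact hswap _ (h p hp)

end Crossings

/-! ### Crossings under `C¹`-convergence -/

/-- Convergence of closed curves in `C¹` along an arbitrary filter. It is phrased pointwise in the
parameter, which covers both regular homotopies and `C¹`-convergent sequences. -/
structure TendstoC1Along {ι : Type*} (l : Filter ι) (f : ι → ℝ → ℂ) (f₀ : ℝ → ℂ) : Prop where
  closed : ∀ᶠ i in l, IsClosedC1 (f i)
  tendsto : ∀ t, Tendsto (fun p : ι × ℝ => f p.1 p.2) (l ×ˢ 𝓝 t) (𝓝 (f₀ t))
  tendsto_deriv :
    ∀ t, Tendsto (fun p : ι × ℝ => deriv (f p.1) p.2) (l ×ˢ 𝓝 t) (𝓝 (deriv f₀ t))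

theorem IsRegularHomotopy.tendstoC1Along {h : ℝ → ℝ → ℂ} (hh : IsRegularHomotopy h) {τ₀ : ℝ}
    (hτ₀ : τ₀ ∈ Icc (0 : ℝ) 1) : TendstoC1Along (𝓝[Icc 0 1] τ₀) h (h τ₀) where
  closed := eventually_mem_nhdsWithin.mono fun τ hτ => (hh.regular τ hτ).toIsClosedC1
  tendsto t := by
    simpa only [ContinuousWithinAt, nhdsWithin_prod_eq, nhdsWithin_univ] using
      hh.cont (τ₀, t) ⟨hτ₀, mem_univ t⟩
  tendsto_deriv t := by
    simpa only [ContinuousWithinAt, nhdsWithin_prod_eq, nhdsWithin_univ] using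
      hh.cont_deriv (τ₀, t) ⟨hτ₀, mem_univ t⟩

theorem tendsto_prod_nhds_of_tendstoUniformly {ι X Y : Type*} [TopologicalSpace X] [UniformSpace Y]
    {l : Filter ι} {F : ι → X → Y} {f : X → Y} (hF : TendstoUniformly F f l) {x : X}
    (hf : ContinuousAt f x) : Tendsto (fun p : ι × X => F p.1 p.2) (l ×ˢ 𝓝 x) (𝓝 (f x)) := by
  have hF' : TendstoUniformly (fun p : ι × X => F p.1) f (l ×ˢ 𝓝 x) :=
    fun u hu => tendsto_fst.eventually (hF u hu)
  exact hF'.tendstoLocallyUniformly.tendsto_comp hf tendsto_snd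

theorem TendstoC1.tendstoC1Along {γs : ℕ → ℝ → ℂ} {Γ : ℝ → ℂ} (h : TendstoC1 γs Γ)
    (hγs : ∀ k, IsClosedC1 (γs k)) : TendstoC1Along atTop γs Γ where
  closed := Eventually.of_forall hγs
  tendsto _ := tendsto_prod_nhds_of_tendstoUniformly h.2.1 h.1.contDiff.continuous.continuousAt
  tendsto_deriv _ := tendsto_prod_nhds_of_tendstoUniformly h.2.2
    (h.1.contDiff.continuous_deriv le_rfl).continuousAt

theorem approximatesLinearOn_sub_prod {E E' F : Type*} [NormedAddCommGroup E] [NormedSpace ℝ E]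
    [NormedAddCommGroup E'] [NormedSpace ℝ E'] [NormedAddCommGroup F] [NormedSpace ℝ F]
    {f : E → F} {g : E' → F} {A : E →L[ℝ] F} {B : E' →L[ℝ] F} {s : Set E} {t : Set E'}
    {c d : NNReal} (hf : ApproximatesLinearOn f A s c) (hg : ApproximatesLinearOn g B t d) :
    ApproximatesLinearOn (fun p : E × E' => f p.1 - g p.2)
      (A.comp (.fst ℝ E E') - B.comp (.snd ℝ E E')) (s ×ˢ t) (c + d) := by
  rintro ⟨x, y⟩ ⟨hx, hy⟩ ⟨x', y'⟩ ⟨hx', hy'⟩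
  calc ‖f x - g y - (f x' - g y') - (A (x - x') - B (y - y'))‖
    _ = ‖f x - f x' - A (x - x') - (g y - g y' - B (y - y'))‖ := by congr 1; abel
    _ ≤ c * ‖x - x'‖ + d * ‖y - y'‖ := norm_sub_le_of_le (hf x hx x' hx') (hg y hy y' hy')
    _ ≤ c * ‖(x, y) - (x', y')‖ + d * ‖(x, y) - (x', y')‖ := by
      gcongr
      · exact norm_fst_le ((x, y) - (x', y'))
      · exact norm_snd_le ((x, y) - (x', y'))
    _ = ↑(c + d) * ‖(x, y) - (x', y')‖ := by push_cast; ring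

theorem eventually_existsUnique_zero {ι E F : Type*} [NormedAddCommGroup E] [NormedSpace ℝ E]
    [CompleteSpace E] [Nontrivial E] [NormedAddCommGroup F] [NormedSpace ℝ F] {l : Filter ι}
    {f : ι → E → F} {x₀ : E} (A : E ≃L[ℝ] F)
    (happ : ∀ c : NNReal, 0 < c →
      ∃ s ∈ 𝓝 x₀, ∀ᶠ i in l, ApproximatesLinearOn (f i) (A : E →L[ℝ] F) s c)
    (hlim : Tendsto (fun i => f i x₀) l (𝓝 0)) {W : Set E} (hW : W ∈ 𝓝 x₀) :
    ∃ U ∈ 𝓝 x₀, U ⊆ W ∧ ∀ᶠ i in l, ∃! x, x ∈ U ∧ f i x = 0 := by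
  have hN : 0 < ‖(A.symm : F →L[ℝ] E)‖₊⁻¹ :=
    inv_pos.2 (A.subsingleton_or_nnnorm_symm_pos.resolve_left (not_subsingleton E))
  obtain ⟨c, hc, hcN⟩ := exists_between hN
  obtain ⟨s, hs, happ⟩ := happ c hc
  obtain ⟨r, hr, hrs⟩ := Metric.nhds_basis_closedBall.mem_iff.1 (inter_mem hs hW)
  refine ⟨_, Metric.closedBall_mem_nhds x₀ hr, hrs.trans inter_subset_right, ?_⟩
  have hpos : 0 < (((‖(A.symm : F →L[ℝ] E)‖₊⁻¹ : NNReal) : ℝ) - c) * r :=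
    mul_pos (sub_pos.2 (NNReal.coe_lt_coe.2 hcN)) hr
  filter_upwards [happ, hlim (Metric.closedBall_mem_nhds 0 hpos)] with i hi hi₀
  have hi := hi.mono_set (hrs.trans inter_subset_left)
  obtain ⟨x, hx, hx0⟩ := hi.surjOn_closedBall_of_nonlinearRightInverse A.toNonlinearRightInverse
    hr.le Subset.rfl (Metric.mem_closedBall_comm.1 hi₀)
  exact ⟨x, ⟨hx, hx0⟩, fun y hy => hi.injOn (Or.inr hcN) hy.1 hx (hy.2.trans hx0.symm)⟩

theorem exists_continuousLinearEquiv_of_linearIndependent {v w : ℂ}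
    (h : LinearIndependent ℝ ![v, w]) : ∃ A : (ℝ × ℝ) ≃L[ℝ] ℂ, (A : ℝ × ℝ →L[ℝ] ℂ) =
      (ContinuousLinearMap.toSpanSingleton ℝ v).comp (.fst ℝ ℝ ℝ) -
        (ContinuousLinearMap.toSpanSingleton ℝ w).comp (.snd ℝ ℝ ℝ) := by
  set L := (ContinuousLinearMap.toSpanSingleton ℝ v).comp (.fst ℝ ℝ ℝ) -
    (ContinuousLinearMap.toSpanSingleton ℝ w).comp (.snd ℝ ℝ ℝ)
  have hL : Function.Injective (L : ℝ × ℝ →ₗ[ℝ] ℂ) := by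
    refine (injective_iff_map_eq_zero _).2 fun p hp => ?_
    obtain ⟨h1, h2⟩ := LinearIndependent.pair_iff.1 h p.1 (-p.2)
      (by simpa [L, sub_eq_add_neg] using hp)
    exact Prod.ext h1 (neg_eq_zero.1 h2)
  exact ⟨(LinearMap.linearEquivOfInjective _ hL (by simp)).toContinuousLinearEquiv, by ext <;> rfl⟩

section TendstoC1Along

variable {ι : Type*} {l : Filter ι} {f : ι → ℝ → ℂ} {f₀ : ℝ → ℂ}

theorem TendstoC1Along.exists_approximatesLinearOn (hf : TendstoC1Along l f f₀) (u : ℝ) {c : NNReal}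
    (hc : 0 < c) : ∃ s ∈ 𝓝 u, ∀ᶠ i in l,
      ApproximatesLinearOn (f i) (ContinuousLinearMap.toSpanSingleton ℝ (deriv f₀ u)) s c := by
  obtain ⟨pa, ha, pb, hb, hab⟩ := eventually_prod_iff.1
    (hf.tendsto_deriv u (Metric.ball_mem_nhds (deriv f₀ u) (NNReal.coe_pos.2 hc)))
  obtain ⟨r, hr, hrb⟩ := Metric.eventually_nhds_iff_ball.1 hb
  refine ⟨_, Metric.ball_mem_nhds u hr, ?_⟩
  filter_upwards [ha, hf.closed] with i hi hclosed x hx y hy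
  have hd : Differentiable ℝ (f i) := hclosed.contDiff.differentiable one_ne_zero
  refine (convex_ball u r).norm_image_sub_le_of_norm_hasFDerivWithin_le'
    (fun t _ => (hd t).hasDerivAt.hasFDerivAt.hasFDerivWithinAt) (fun t ht => ?_) hy hx
  have ht := (mem_ball_iff_norm.1 (hab hi (hrb t ht))).le
  refine ContinuousLinearMap.opNorm_le_bound _ c.coe_nonneg fun a => ?_
  simpa only [sub_apply, ContinuousLinearMap.toSpanSingleton_apply,
    ← smul_sub, norm_smul, mul_comm ‖a‖] using mul_le_mul_of_nonneg_right ht (norm_nonneg a)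

theorem TendstoC1Along.exists_unique_crossing (hf : TendstoC1Along l f f₀) {z : ℝ × ℝ}
    (hz : f₀ z.1 = f₀ z.2) (hli : LinearIndependent ℝ ![deriv f₀ z.1, deriv f₀ z.2])
    {W : Set (ℝ × ℝ)} (hW : W ∈ 𝓝 z) :
    ∃ U ∈ 𝓝 z, U ⊆ W ∧ ∀ᶠ i in l, ∃! p : ℝ × ℝ, p ∈ U ∧ f i p.1 = f i p.2 := by
  obtain ⟨A, hA⟩ := exists_continuousLinearEquiv_of_linearIndependent hli
  simp only [← sub_eq_zero (a := f _ _)]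
  refine eventually_existsUnique_zero A (fun c hc => ?_) ?_ hW
  · obtain ⟨s, hs, hs'⟩ := hf.exists_approximatesLinearOn z.1 (half_pos hc)
    obtain ⟨t, ht, ht'⟩ := hf.exists_approximatesLinearOn z.2 (half_pos hc)
    refine ⟨s ×ˢ t, prod_mem_nhds hs ht, ?_⟩
    filter_upwards [hs', ht'] with i hi hi'
    simpa only [hA, add_halves] using approximatesLinearOn_sub_prod hi hi'
  · have hlim (t : ℝ) : Tendsto (fun i => f i t) l (𝓝 (f₀ t)) :=
      (hf.tendsto t).comp (tendsto_id.prodMk tendsto_const_nhds)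
    simpa only [hz, sub_self] using (hlim z.1).sub (hlim z.2)

theorem TendstoC1Along.eventually_apply_ne (hf : TendstoC1Along l f f₀) {z : ℝ × ℝ}
    (hz : f₀ z.1 ≠ f₀ z.2) : ∀ᶠ p : ι × ℝ × ℝ in l ×ˢ 𝓝 z, f p.1 p.2.1 ≠ f p.1 p.2.2 := by
  rw [nhds_prod_eq]
  have h1 : Tendsto (fun p : ι × ℝ × ℝ => f p.1 p.2.1) (l ×ˢ 𝓝 z.1 ×ˢ 𝓝 z.2) (𝓝 (f₀ z.1)) :=
    (hf.tendsto z.1).comp (tendsto_fst.prodMk (tendsto_fst.comp tendsto_snd))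
  have h2 : Tendsto (fun p : ι × ℝ × ℝ => f p.1 p.2.2) (l ×ˢ 𝓝 z.1 ×ˢ 𝓝 z.2) (𝓝 (f₀ z.2)) :=
    (hf.tendsto z.2).comp (tendsto_fst.prodMk (tendsto_snd.comp tendsto_snd))
  exact ((h1.sub h2).eventually_ne (sub_ne_zero.2 hz)).mono fun _ => sub_ne_zero.1

theorem TendstoC1Along.exists_injOn (hf : TendstoC1Along l f f₀) {u : ℝ} (hu : deriv f₀ u ≠ 0) :
    ∃ s ∈ 𝓝 u, ∀ᶠ i in l, InjOn (f i) s := by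
  obtain ⟨c, hc, hcu⟩ := exists_between (nnnorm_pos.2 hu)
  obtain ⟨s, hs, happ⟩ := hf.exists_approximatesLinearOn u hc
  refine ⟨s, hs, happ.mono fun i hi x hx y hy hxy => ?_⟩
  have h := hi x hx y hy
  rw [hxy, sub_self, zero_sub, norm_neg, ContinuousLinearMap.toSpanSingleton_apply, norm_smul,
    mul_comm] at h
  by_contra hne
  exact absurd (le_of_mul_le_mul_right h (norm_pos_iff.2 (sub_ne_zero.2 hne)))
    (not_le.2 (NNReal.coe_lt_coe.2 hcu))

theorem TendstoC1Along.eventually_notMem_crossings (hf : TendstoC1Along l f f₀)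
    (hf₀ : ∀ t, deriv f₀ t ≠ 0) {P : UnitAddCircle × UnitAddCircle} (hP : P ∉ crossings f₀) :
    ∀ᶠ p in l ×ˢ 𝓝 P, p.2 ∉ crossings (f p.1) := by
  obtain ⟨z, rfl⟩ := isOpenQuotientMap_toTorus.surjective P
  by_cases hz : (z.1 : UnitAddCircle) = z.2
  · obtain ⟨s, hs, hinj⟩ := hf.exists_injOn (hf₀ z.1)
    have hz : toTorus z = toTorus (z.1, z.1) := Prod.ext rfl hz.symm
    rw [hz, ← map_toTorus_nhds, prod_map_right, eventually_map]
    filter_upwards [(hinj.and hf.closed).prod_mk (prod_mem_nhds hs hs)]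
      with p ⟨⟨hi, hclosed⟩, hp⟩ hmem
    obtain ⟨hne, heq⟩ := (toTorus_mem_crossings hclosed.periodic).1 hmem
    exact hne (congrArg _ (hi hp.1 hp.2 heq))
  · rw [← map_toTorus_nhds, prod_map_right, eventually_map]
    filter_upwards [hf.eventually_apply_ne fun h => hP ⟨hz, z, rfl, h⟩,
      hf.closed.prod_inl _] with p hp hclosed hmem
    exact hp ((toTorus_mem_crossings hclosed.periodic).1 hmem).2

end TendstoC1Along

theorem eventually_forall_of_isCompact {ι X : Type*} [TopologicalSpace X] {l : Filter ι} {K : Set X}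
    (hK : IsCompact K) {R : ι × X → Prop} (h : ∀ x ∈ K, ∀ᶠ p in l ×ˢ 𝓝 x, R p) :
    ∀ᶠ i in l, ∀ x ∈ K, R (i, x) := by
  have hR : ∀ᶠ p in l ×ˢ 𝓝ˢ K, R p := hK.mem_prod_nhdsSet_of_forall h
  exact hR.curry.mono fun i hi => subset_of_mem_nhdsSet hi

theorem ncard_eq_of_existsUnique {X : Type*} {Z Z₀ : Set X} {U : X → Set X}
    (hdisj : Z₀.PairwiseDisjoint U) (hcover : Z ⊆ ⋃ x ∈ Z₀, U x)
    (huniq : ∀ x ∈ Z₀, ∃! z, z ∈ U x ∧ z ∈ Z) : Z.ncard = Z₀.ncard := by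
  choose! g hg hg' using huniq
  have himage : Z = g '' Z₀ := by
    refine Subset.antisymm (fun z hz => ?_) (image_subset_iff.2 fun x hx => (hg x hx).2)
    obtain ⟨x, hx, hzx⟩ := mem_iUnion₂.1 (hcover hz)
    exact ⟨x, hx, (hg' x hx z ⟨hzx, hz⟩).symm⟩
  rw [himage, InjOn.ncard_image]
  exact fun x hx y hy hxy => hdisj.elim_set hx hy (g x) (hg x hx).1 (hxy ▸ (hg y hy).1)

theorem eventually_ncard_eq {ι X : Type*} [TopologicalSpace X] [T2Space X] [CompactSpace X]
    {l : Filter ι} {Z : ι → Set X} {Z₀ : Set X} (hfin : Z₀.Finite)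
    (huniq : ∀ x ∈ Z₀, ∀ W ∈ 𝓝 x, ∃ U ∈ 𝓝 x, U ⊆ W ∧ ∀ᶠ i in l, ∃! z, z ∈ U ∧ z ∈ Z i)
    (hnot : ∀ x ∉ Z₀, ∀ᶠ p in l ×ˢ 𝓝 x, p.2 ∉ Z p.1) :
    ∀ᶠ i in l, (Z i).ncard = Z₀.ncard := by
  obtain ⟨W, hW, hdisj⟩ := hfin.t2_separation
  choose! U hU hUW huniq using fun x hx => huniq x hx (W x) ((hW x).2.mem_nhds (hW x).1)
  have hK : IsCompact (⋃ x ∈ Z₀, interior (U x))ᶜ :=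
    (isOpen_biUnion fun _ _ => isOpen_interior).isClosed_compl.isCompact
  have hrest := eventually_forall_of_isCompact hK fun x hx => hnot x fun h =>
    hx (mem_biUnion h (mem_interior_iff_mem_nhds.2 (hU x h)))
  filter_upwards [hrest, hfin.eventually_all.2 huniq] with i hi huniq
  refine ncard_eq_of_existsUnique (hdisj.mono_on hUW) (fun z hz => ?_) huniq
  have hz : z ∈ ⋃ x ∈ Z₀, interior (U x) := not_notMem.1 fun h => hi z h hz
  exact iUnion₂_mono (fun _ _ => interior_subset) hz

theorem IsGeneric.linearIndependent_deriv {γ : ℝ → ℂ} (hγ : IsGeneric γ) {z : ℝ × ℝ}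
    (hz : toTorus z ∈ crossings γ) : LinearIndependent ℝ ![deriv γ z.1, deriv γ z.2] := by
  have hd := periodic_deriv hγ.periodic
  refine forall_crossing_of_forall_selfInt hγ.periodic
    (R := fun P => ∀ z, toTorus z = P → LinearIndependent ℝ ![deriv γ z.1, deriv γ z.2])
    (fun P hP z hz => LinearIndependent.pair_symm_iff.1 (hP z.swap (congrArg Prod.swap hz)))
    (fun p hp z hz => ?_) hz z rfl
  obtain ⟨h1, h2⟩ := Prod.ext_iff.1 hz
  rw [apply_eq_of_coe_eq hd h1, apply_eq_of_coe_eq hd h2]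
  exact hγ.transverse p hp

theorem TendstoC1Along.eventually_ncard_crossings_eq {ι : Type*} {l : Filter ι} {f : ι → ℝ → ℂ}
    {f₀ : ℝ → ℂ} (hf : TendstoC1Along l f f₀) (hf₀ : IsGeneric f₀) :
    ∀ᶠ i in l, (crossings (f i)).ncard = (crossings f₀).ncard := by
  refine eventually_ncard_eq (finite_crossings hf₀.periodic hf₀.finite) ?_
    fun P hP => hf.eventually_notMem_crossings hf₀.deriv_ne_zero hP
  intro P hP W hW
  obtain ⟨z, rfl⟩ := isOpenQuotientMap_toTorus.surjective P
  have hne : ∀ᶠ P in 𝓝 (toTorus z), P.1 ≠ P.2 :=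
    (isOpen_ne_fun continuous_fst continuous_snd).mem_nhds hP.1
  have hWz := isOpenQuotientMap_toTorus.continuous.continuousAt (inter_mem hW hne)
  obtain ⟨U, hU, hUW, huniq⟩ := hf.exists_unique_crossing
    ((toTorus_mem_crossings hf₀.periodic).1 hP).2 (hf₀.linearIndependent_deriv hP) hWz
  refine ⟨toTorus '' U, isOpenQuotientMap_toTorus.isOpenMap.image_mem_nhds hU,
    image_subset_iff.2 fun p hp => (hUW hp).1, ?_⟩
  filter_upwards [huniq, hf.closed] with i ⟨p, ⟨hpU, hp⟩, hpuniq⟩ hclosed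
  refine ⟨toTorus p, ⟨⟨p, hpU, rfl⟩, (hUW hpU).2, p, rfl, hp⟩, ?_⟩
  rintro _ ⟨⟨p', hp'U, rfl⟩, hp'⟩
  rw [hpuniq p' ⟨hp'U, ((toTorus_mem_crossings hclosed.periodic).1 hp').2⟩]

theorem IsRegularHomotopy.ncard_crossings_eq {h : ℝ → ℝ → ℂ} (hh : IsRegularHomotopy h)
    (hg : ∀ τ ∈ Icc (0 : ℝ) 1, IsGeneric (h τ)) :
    (crossings (h 0)).ncard = (crossings (h 1)).ncard := by
  refine isPreconnected_Icc.constant (f := fun τ => (crossings (h τ)).ncard)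
    (fun τ hτ => ?_) (left_mem_Icc.2 zero_le_one) (right_mem_Icc.2 zero_le_one)
  exact tendsto_const_nhds.congr' (((hh.tendstoC1Along hτ).eventually_ncard_crossings_eq
    (hg τ hτ)).mono fun _ h' => h'.symm)

theorem IsCompartment.ncard_crossings_eq {jp jm s ω : ℤ} {C : Set (ℝ → ℂ)}
    (hC : IsCompartment jp jm s ω C) {γ β : ℝ → ℂ} (hγ : γ ∈ C) (hβ : β ∈ C) :
    (crossings γ).ncard = (crossings β).ncard := by
  obtain ⟨γ₀, -, rfl⟩ := hC
  obtain ⟨h, hh, hg, h0, rfl⟩ := hγ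
  obtain ⟨h', hh', hg', h0', rfl⟩ := hβ
  rw [← hh.ncard_crossings_eq fun τ hτ => (hg τ hτ).1,
    ← hh'.ncard_crossings_eq fun τ hτ => (hg' τ hτ).1, h0, h0']

/-! ### The energy of curves parametrized by arclength -/

/-- The integrand of the tangent-point energy of a curve parametrized by arclength. For `q ≠ 0` it
vanishes (as `0 / 0 = 0`) where `γ z.1 = γ z.2`. -/
def tpDensity (q : ℝ) (γ : ℝ → ℂ) (z : ℝ × ℝ) : ℝ≥0∞ :=
  ENNReal.ofReal ((2 * |cross (deriv γ z.2) (γ z.1 - γ z.2)| / ‖γ z.2 - γ z.1‖ ^ 2) ^ q)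

theorem measurable_tpDensity {γ : ℝ → ℂ} (hγ : Continuous γ) (q : ℝ) :
    Measurable (tpDensity q γ) := by
  have := hγ.measurable
  have := measurable_deriv γ
  unfold tpDensity
  simp only [Complex.areaForm]
  fun_prop

section UnitSpeed

variable {γ : ℝ → ℂ}

theorem arcDist_eq_dist (hspeed : ∀ t, ‖deriv γ t‖ = 1) (x y : ℝ) :
    arcDist γ x y = dist (x : UnitAddCircle) y := by
  have harc : arcDist γ x y = ⨅ k : ℤ, |x - y - k| := by
    simp only [arcDist, hspeed, intervalIntegral.integral_const, smul_eq_mul, mul_one]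
    exact iInf_congr fun k => by rw [abs_sub_comm, sub_sub]
  rw [harc, dist_eq_norm, ← AddCircle.coe_sub, UnitAddCircle.norm_eq]
  exact le_antisymm (ciInf_le ⟨0, forall_mem_range.2 fun k => abs_nonneg _⟩ _)
    (le_ciInf (round_le (x - y)))

theorem truncSet_eq_preimage_thickening (hγ : Function.Periodic γ 1)
    (hspeed : ∀ t, ‖deriv γ t‖ = 1) (δ : ℝ) :
    truncSet γ δ = toTorus ⁻¹' Metric.thickening δ (crossings γ) := by
  ext z
  simp only [crossings_eq_image hγ, Metric.thickening_union, preimage_union, mem_union,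
    mem_preimage, Metric.mem_thickening_iff, exists_mem_image, Prod.dist_eq, max_lt_iff, truncSet,
    mem_ofPred_eq, arcDist_eq_dist hspeed, and_or_left, exists_or]
  rfl

theorem isOpen_truncSet (hγ : Function.Periodic γ 1) (hspeed : ∀ t, ‖deriv γ t‖ = 1) (δ : ℝ) :
    IsOpen (truncSet γ δ) := by
  rw [truncSet_eq_preimage_thickening hγ hspeed]
  exact Metric.isOpen_thickening.preimage isOpenQuotientMap_toTorus.continuous

theorem infDist_tangentLine {t : ℝ} (hspeed : ‖deriv γ t‖ = 1) (w : ℂ) :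
    Metric.infDist w (tangentLine γ t) = |cross (deriv γ t) (w - γ t)| := by
  set v := deriv γ t with hv
  have hcross (c : ℝ) : cross v (w - (γ t + c • v)) = cross v (w - γ t) := by
    rw [← sub_sub, map_sub, map_smul, Orientation.areaForm_apply_self, smul_zero, sub_zero]
  apply le_antisymm
  · have hfoot : γ t + inner ℝ v (w - γ t) • v ∈ tangentLine γ t := ⟨_, rfl⟩
    have hperp : inner ℝ v (w - (γ t + inner ℝ v (w - γ t) • v)) = 0 := by
      rw [← sub_sub, inner_sub_right, inner_smul_right, real_inner_self_eq_norm_sq, hspeed]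
      ring
    have hnorm := Complex.orientation.inner_sq_add_areaForm_sq v
      (w - (γ t + inner ℝ v (w - γ t) • v))
    rw [hperp, hcross, hspeed, zero_pow two_ne_zero, zero_add, one_pow, one_mul, ← sq_abs] at hnorm
    rw [(pow_left_inj₀ (abs_nonneg _) (norm_nonneg _) two_ne_zero).1 hnorm, ← dist_eq_norm]
    exact Metric.infDist_le_dist_of_mem hfoot
  · refine (Metric.le_infDist (show (tangentLine γ t).Nonempty from ⟨_, 0, rfl⟩)).2 ?_
    rintro _ ⟨c, rfl⟩
    simpa only [hcross, ← hv, hspeed, one_mul, dist_eq_norm] using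
      Complex.orientation.abs_areaForm_le v (w - (γ t + c • v))

theorem truncEnergy_eq (hspeed : ∀ t, ‖deriv γ t‖ = 1) (q δ : ℝ) :
    truncEnergy q δ γ =
      ∫⁻ z in (Ico (0 : ℝ) 1 ×ˢ Ico (0 : ℝ) 1) \ truncSet γ δ, tpDensity q γ z := by
  simp only [truncEnergy, tpDensity, infDist_tangentLine (hspeed _), hspeed, mul_one]

end UnitSpeed

theorem truncEnergy_add_const {γ : ℝ → ℂ} (hspeed : ∀ t, ‖deriv γ t‖ = 1) (q δ : ℝ) (a : ℂ) :
    truncEnergy q δ (fun t => γ t + a) = truncEnergy q δ γ := by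
  have hspeed' (t : ℝ) : ‖deriv (fun t => γ t + a) t‖ = 1 := by rw [deriv_add_const, hspeed]
  simp only [truncEnergy_eq hspeed, truncEnergy_eq hspeed', tpDensity, truncSet, selfInt, arcDist,
    deriv_add_const, add_sub_add_right_eq_sub, add_left_inj]

/-! ### Lower semicontinuity -/

theorem TendstoC1Along.eventually_notMem_truncSet {ι : Type*} {l : Filter ι} {f : ι → ℝ → ℂ}
    {f₀ : ℝ → ℂ} (hf : TendstoC1Along l f f₀) (hclosed : IsClosedC1 f₀)
    (hspeed : ∀ᶠ i in l, ∀ t, ‖deriv (f i) t‖ = 1) (hspeed₀ : ∀ t, ‖deriv f₀ t‖ = 1) {δ δ' : ℝ}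
    (hδ : δ' < δ) {z : ℝ × ℝ} (hz : z ∉ truncSet f₀ δ) : ∀ᶠ i in l, z ∉ truncSet (f i) δ' := by
  simp only [truncSet_eq_preimage_thickening hclosed.periodic hspeed₀, mem_preimage,
    Metric.mem_thickening_iff, not_exists, not_and, not_lt] at hz
  have hball : ∀ P ∈ Metric.closedBall (toTorus z) δ', P ∉ crossings f₀ := fun P hP hP' =>
    (Metric.mem_closedBall'.1 hP).not_gt (hδ.trans_le (hz P hP'))
  filter_upwards [hspeed, hf.closed, eventually_forall_of_isCompact
    Metric.isClosed_closedBall.isCompact fun P hP => hf.eventually_notMem_crossings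
      (fun t => norm_ne_zero_iff.1 (by simp [hspeed₀])) (hball P hP)] with i hi hclosed hcross
  rw [truncSet_eq_preimage_thickening hclosed.periodic hi, mem_preimage,
    Metric.mem_thickening_iff]
  rintro ⟨P, hP, hzP⟩
  exact hcross P (Metric.mem_closedBall'.2 hzP.le) hP

theorem TendstoC1Along.tendsto_tpDensity {ι : Type*} {l : Filter ι} {f : ι → ℝ → ℂ}
    {f₀ : ℝ → ℂ} (hf : TendstoC1Along l f f₀) {q : ℝ} (hq : 0 < q) {z : ℝ × ℝ}
    (hz : f₀ z.1 ≠ f₀ z.2) :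
    Tendsto (fun i => tpDensity q (f i) z) l (𝓝 (tpDensity q f₀ z)) := by
  have hlim (t : ℝ) : Tendsto (fun i => f i t) l (𝓝 (f₀ t)) :=
    (hf.tendsto t).comp (tendsto_id.prodMk tendsto_const_nhds)
  have hlim' : Tendsto (fun i => deriv (f i) z.2) l (𝓝 (deriv f₀ z.2)) :=
    (hf.tendsto_deriv z.2).comp (tendsto_id.prodMk tendsto_const_nhds)
  have hcross : Tendsto (fun i => cross (deriv (f i) z.2) (f i z.1 - f i z.2)) l
      (𝓝 (cross (deriv f₀ z.2) (f₀ z.1 - f₀ z.2))) := by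
    simp only [Complex.areaForm]
    exact (Complex.continuous_im.tendsto _).comp
      (((Complex.continuous_conj.tendsto _).comp hlim').mul ((hlim z.1).sub (hlim z.2)))
  have hne : ‖f₀ z.2 - f₀ z.1‖ ^ 2 ≠ 0 :=
    pow_ne_zero 2 (norm_ne_zero_iff.2 (sub_ne_zero.2 hz.symm))
  exact (ENNReal.continuous_ofReal.tendsto _).comp
    (((hcross.abs.const_mul 2).div (((hlim z.2).sub (hlim z.1)).norm.pow 2) hne).rpow_const
      (Or.inr hq.le))

theorem tpDensity_eq_zero {q : ℝ} (hq : q ≠ 0) {γ : ℝ → ℂ} {z : ℝ × ℝ} (hz : γ z.1 = γ z.2) :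
    tpDensity q γ z = 0 := by
  simp [tpDensity, hz, Real.zero_rpow hq]

theorem TendstoC1.truncEnergy_le_liminf {q δ δ' : ℝ} (hq : 0 < q) (hδ : δ' < δ)
    {γs : ℕ → ℝ → ℂ} {Γ : ℝ → ℂ} (hΓ : TendstoC1 γs Γ) (hclosed : ∀ k, IsClosedC1 (γs k))
    (hspeed : ∀ k t, ‖deriv (γs k) t‖ = 1) :
    truncEnergy q δ Γ ≤ liminf (fun k => truncEnergy q δ' (γs k)) atTop := by
  have hlim := hΓ.tendstoC1Along hclosed
  have hspeed₀ (t : ℝ) : ‖deriv Γ t‖ = 1 := by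
    refine tendsto_nhds_unique (hΓ.2.2.tendsto_at t).norm ?_
    simp only [hspeed, tendsto_const_nhds]
  have hmeas {γ : ℝ → ℂ} (hγ : IsClosedC1 γ) (h : ∀ t, ‖deriv γ t‖ = 1) (δ : ℝ) :
      MeasurableSet ((Ico (0 : ℝ) 1 ×ˢ Ico (0 : ℝ) 1) \ truncSet γ δ) :=
    (measurableSet_Ico.prod measurableSet_Ico).diff (isOpen_truncSet hγ.periodic h δ).measurableSet
  simp only [truncEnergy_eq hspeed₀, truncEnergy_eq (hspeed _),
    ← lintegral_indicator (hmeas hΓ.1 hspeed₀ δ),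
    ← lintegral_indicator (hmeas (hclosed _) (hspeed _) δ')]
  refine le_trans (lintegral_mono fun z => ?_) (lintegral_liminf_le fun k =>
    (measurable_tpDensity (hclosed k).contDiff.continuous q).indicator
      (hmeas (hclosed k) (hspeed k) δ'))
  by_cases hz : z ∈ (Ico (0 : ℝ) 1 ×ˢ Ico (0 : ℝ) 1) \ truncSet Γ δ
  · rw [indicator_of_mem hz]
    rcases eq_or_ne (Γ z.1) (Γ z.2) with heq | hne
    · rw [tpDensity_eq_zero hq.ne' heq]
      exact bot_le
    · rw [← (hlim.tendsto_tpDensity hq hne).liminf_eq]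
      refine liminf_le_liminf ?_
      filter_upwards [hlim.eventually_notMem_truncSet hΓ.1 (Eventually.of_forall hspeed) hspeed₀ hδ
        hz.2] with k hk
      exact (indicator_of_mem (mem_sdiff_of_mem hz.1 hk) _).ge
  · rw [indicator_of_notMem hz]
    exact bot_le

/-! ### The energy of two crossing lines -/

theorem lintegral_comp_affine {g : ℝ → ℝ≥0∞} (hg : Measurable g) {a : ℝ} (ha : a ≠ 0) (b : ℝ) :
    ENNReal.ofReal |a| * ∫⁻ x, g (b + a * x) = ∫⁻ x, g x := by
  rw [← lintegral_add_left_eq_self g b, ← smul_eq_mul, ← lintegral_smul_measure]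
  conv_rhs => rw [← Real.smul_map_volume_mul_left ha]
  rw [lintegral_smul_measure, lintegral_smul_measure, lintegral_map (by fun_prop) (by fun_prop)]

theorem lintegral_prod_eq_lintegral_slope {F : ℝ × ℝ → ℝ≥0∞} (hF : Measurable F) :
    ∫⁻ z, F z = ∫⁻ m, ∫⁻ a, ENNReal.ofReal |a| * F (a • ((1 : ℝ), m)) := by
  rw [lintegral_lintegral_swap (by fun_prop), Measure.volume_eq_prod,
    lintegral_prod _ hF.aemeasurable]
  refine lintegral_congr_ae ?_
  filter_upwards [Measure.ae_ne volume 0] with a ha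
  rw [lintegral_const_mul _ (by fun_prop), ← lintegral_comp_affine (by fun_prop) ha 0]
  simp only [Prod.smul_mk, smul_eq_mul, mul_one, zero_add]

section Homogeneous

variable {F : ℝ × ℝ → ℝ≥0∞} {p : ℝ}

theorem abs_mul_indicator_annulus_smul
    (hhom : ∀ a : ℝ, a ≠ 0 → ∀ z, F (a • z) = ENNReal.ofReal (|a| ^ p) * F z) (r R : ℝ) {a : ℝ}
    (ha : a ≠ 0) {z : ℝ × ℝ} (hz : z ≠ 0) :
    ENNReal.ofReal |a| * (Metric.ball 0 R \ Metric.ball 0 r).indicator F (a • z) =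
      F z * (ENNReal.ofReal (‖z‖ ^ (-(p + 1))) *
        (Metric.ball 0 R \ Metric.ball 0 r).indicator (fun x => ENNReal.ofReal (|x| ^ (p + 1)))
          (‖z‖ * a)) := by
  have hz0 : 0 < ‖z‖ := norm_pos_iff.2 hz
  have hnorm : ‖a • z‖ = ‖‖z‖ * a‖ := by rw [norm_smul, norm_mul, norm_norm, mul_comm]
  have hmem : a • z ∈ Metric.ball 0 R \ Metric.ball 0 r ↔
      ‖z‖ * a ∈ Metric.ball (0 : ℝ) R \ Metric.ball 0 r := by
    simp only [Set.mem_sdiff, mem_ball_zero_iff, hnorm]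
  by_cases h : ‖z‖ * a ∈ Metric.ball (0 : ℝ) R \ Metric.ball 0 r
  · rw [indicator_of_mem h, indicator_of_mem (hmem.2 h), hhom a ha, abs_mul, abs_norm,
      Real.mul_rpow hz0.le (abs_nonneg a), ← ENNReal.ofReal_mul (by positivity), ← mul_assoc,
      ← ENNReal.ofReal_mul (abs_nonneg a), mul_comm (F z), ← mul_assoc, Real.rpow_neg hz0.le,
      inv_mul_cancel₀ (by positivity), one_mul, Real.rpow_add_one (abs_ne_zero.2 ha),
      mul_comm |a|]
  · rw [indicator_of_notMem h, indicator_of_notMem (mt hmem.1 h), mul_zero, mul_zero, mul_zero]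

theorem setLIntegral_annulus_of_homogeneous (hF : Measurable F)
    (hhom : ∀ a : ℝ, a ≠ 0 → ∀ z, F (a • z) = ENNReal.ofReal (|a| ^ p) * F z) (r R : ℝ) :
    ∫⁻ z in Metric.ball 0 R \ Metric.ball 0 r, F z =
      (∫⁻ m, ENNReal.ofReal (‖((1 : ℝ), m)‖ ^ (-(p + 2))) * F (1, m)) *
        ∫⁻ a in Metric.ball (0 : ℝ) R \ Metric.ball 0 r, ENNReal.ofReal (|a| ^ (p + 1)) := by
  rw [← lintegral_indicator (measurableSet_ball.diff measurableSet_ball),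
    ← lintegral_indicator (measurableSet_ball.diff measurableSet_ball)]
  set G : ℝ → ℝ≥0∞ :=
    (Metric.ball (0 : ℝ) R \ Metric.ball 0 r).indicator fun a => ENNReal.ofReal (|a| ^ (p + 1))
  have hG : Measurable G :=
    Measurable.indicator (by fun_prop) (measurableSet_ball.diff measurableSet_ball)
  rw [lintegral_prod_eq_lintegral_slope
    (hF.indicator (measurableSet_ball.diff measurableSet_ball)), ← lintegral_mul_const _
    (by fun_prop)]
  refine lintegral_congr fun m => ?_
  set z : ℝ × ℝ := (1, m)
  have hz : z ≠ 0 := by simp [z]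
  have hz0 : 0 < ‖z‖ := norm_pos_iff.2 hz
  calc ∫⁻ a, ENNReal.ofReal |a| * (Metric.ball 0 R \ Metric.ball 0 r).indicator F (a • z)
      = ∫⁻ a, F z * (ENNReal.ofReal (‖z‖ ^ (-(p + 1))) * G (‖z‖ * a)) := by
        refine lintegral_congr_ae ?_
        filter_upwards [Measure.ae_ne volume 0] with a ha using
          abs_mul_indicator_annulus_smul hhom r R ha hz
    _ = F z * (ENNReal.ofReal (‖z‖ ^ (-(p + 2))) *
          (ENNReal.ofReal |‖z‖| * ∫⁻ a, G (0 + ‖z‖ * a))) := by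
        have hpow : ‖z‖ ^ (-(p + 2)) * ‖z‖ = ‖z‖ ^ (-(p + 1)) := by
          rw [← Real.rpow_add_one hz0.ne']
          ring_nf
        rw [lintegral_const_mul _ (by fun_prop), lintegral_const_mul _ (by fun_prop), abs_norm,
          ← mul_assoc (ENNReal.ofReal _), ← ENNReal.ofReal_mul (by positivity), hpow]
        simp only [zero_add]
    _ = ENNReal.ofReal (‖z‖ ^ (-(p + 2))) * F z * ∫⁻ a, G a := by
        rw [lintegral_comp_affine hG hz0.ne', ← mul_assoc, mul_comm (F z)]

end Homogeneous

/-- The integrand of the tangent-point energy of two straight lines, parametrized by arclength,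
that meet at the parameters `(0, 0)` at an angle with sine `s` and cosine `c`. -/
def lineDensity (q s c : ℝ) (z : ℝ × ℝ) : ℝ≥0∞ :=
  ENNReal.ofReal ((2 * (|z.1| * s) / (z.1 ^ 2 + z.2 ^ 2 - 2 * (z.1 * z.2 * c))) ^ q)

/-- The contribution of the parameters in a square annulus to the energy of two crossing lines. -/
def lineEnergy (q s c δ' δ : ℝ) : ℝ≥0∞ :=
  ∫⁻ z in Metric.ball 0 δ \ Metric.ball 0 δ', lineDensity q s c z

theorem measurable_lineDensity (q s c : ℝ) : Measurable (lineDensity q s c) := by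
  unfold lineDensity
  fun_prop

theorem lineDensity_smul {q s c : ℝ} (hs : 0 ≤ s) (hc : c ^ 2 ≤ 1) {a : ℝ} (ha : a ≠ 0)
    (z : ℝ × ℝ) :
    lineDensity q s c (a • z) = ENNReal.ofReal (|a| ^ (-q)) * lineDensity q s c z := by
  have ha0 : 0 < |a| := abs_pos.2 ha
  have hden : 0 ≤ z.1 ^ 2 + z.2 ^ 2 - 2 * (z.1 * z.2 * c) := by
    nlinarith [sq_nonneg (z.1 - c * z.2), mul_nonneg (sub_nonneg.2 hc) (sq_nonneg z.2)]
  have hdensmul : (a * z.1) ^ 2 + (a * z.2) ^ 2 - 2 * (a * z.1 * (a * z.2) * c) =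
      |a| ^ 2 * (z.1 ^ 2 + z.2 ^ 2 - 2 * (z.1 * z.2 * c)) := by
    rw [sq_abs]
    ring
  have hquot : 2 * (|a| * |z.1| * s) / (|a| ^ 2 * (z.1 ^ 2 + z.2 ^ 2 - 2 * (z.1 * z.2 * c))) =
      |a|⁻¹ * (2 * (|z.1| * s) / (z.1 ^ 2 + z.2 ^ 2 - 2 * (z.1 * z.2 * c))) := by
    field_simp
  simp only [lineDensity, Prod.smul_fst, Prod.smul_snd, smul_eq_mul, hdensmul, abs_mul, hquot]
  rw [Real.mul_rpow (by positivity) (by positivity), Real.inv_rpow ha0.le, ← Real.rpow_neg ha0.le,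
    ENNReal.ofReal_mul (by positivity)]

theorem norm_one_affine {s : ℝ} (hs : 0 < s) (c y : ℝ) :
    ‖((1 : ℝ), c + s * y)‖ = s * max s⁻¹ |c / s + y| := by
  rw [mul_max_of_nonneg _ _ hs.le, mul_inv_cancel₀ hs.ne', ← abs_of_pos hs, ← abs_mul,
    abs_of_pos hs, mul_add, mul_div_cancel₀ _ hs.ne', Prod.norm_def, norm_one, Real.norm_eq_abs]

theorem lineDensity_one_affine {q s c : ℝ} (hs : s ≠ 0) (hsc : c ^ 2 + s ^ 2 = 1) (y : ℝ) :
    lineDensity q s c (1, c + s * y) = ENNReal.ofReal ((2 / (1 + y ^ 2) / s) ^ q) := by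
  have hden : 1 ^ 2 + (c + s * y) ^ 2 - 2 * (1 * (c + s * y) * c) = s ^ 2 * (1 + y ^ 2) := by
    linear_combination -hsc
  have hy : 1 + y ^ 2 ≠ 0 := by positivity
  rw [lineDensity, hden, abs_one, one_mul]
  congr 2
  field_simp

/-- The angular density of the energy of two lines that cross at an angle with cosecant `t` and
cotangent `k`. A direction in the parameter plane is given by `y`, where its slope is `(k + y) / t`;
in this coordinate the factor `2 / (1 + y ^ 2)` does not depend on the angle. -/
def lineWeight (q t k y : ℝ) : ℝ≥0∞ :=
  ENNReal.ofReal ((2 / (1 + y ^ 2)) ^ q * (t * max t |k + y| ^ (q - 2)))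

theorem lineEnergy_eq {q s c : ℝ} (hs : 0 < s) (hsc : c ^ 2 + s ^ 2 = 1) (δ' δ : ℝ) :
    lineEnergy q s c δ' δ = (∫⁻ y, lineWeight q s⁻¹ (c / s) y) *
      ∫⁻ a in Metric.ball (0 : ℝ) δ \ Metric.ball 0 δ', ENNReal.ofReal (|a| ^ (-q + 1)) := by
  have hc : c ^ 2 ≤ 1 := by nlinarith
  have hm := measurable_lineDensity q s c
  rw [lineEnergy, setLIntegral_annulus_of_homogeneous hm fun a ha z =>
    lineDensity_smul hs.le hc ha z, ← lintegral_comp_affine (by fun_prop) hs.ne' c]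
  congr 1
  rw [← lintegral_const_mul _ (by fun_prop)]
  refine lintegral_congr fun y => ?_
  have hm0 : 0 < max s⁻¹ |c / s + y| := lt_max_of_lt_left (inv_pos.2 hs)
  have hpow : s ^ (q - 2) * s ^ 2 = s ^ q := by
    rw [← Real.rpow_two, ← Real.rpow_add hs, sub_add_cancel]
  rw [norm_one_affine hs, lineDensity_one_affine hs.ne' hsc, abs_of_pos hs, lineWeight,
    ← ENNReal.ofReal_mul (by positivity), ← ENNReal.ofReal_mul hs.le, neg_add', neg_neg,
    Real.mul_rpow hs.le hm0.le, Real.div_rpow (by positivity) hs.le, ← hpow]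
  congr 1
  field_simp

section RightAngle

variable {t k y : ℝ}

theorem two_mul_max_one_abs_le (ht : 1 ≤ t) :
    2 * max 1 |y| ≤ max t |k + y| + max t |k - y| := by
  rw [mul_max_of_nonneg _ _ zero_le_two]
  refine max_le ?_ ?_
  · linarith [le_max_left t |k + y|, le_max_left t |k - y|]
  · calc 2 * |y| = |(k + y) - (k - y)| := by rw [← abs_two, ← abs_mul]; congr 1; ring
      _ ≤ |k + y| + |k - y| := abs_sub _ _
      _ ≤ max t |k + y| + max t |k - y| := add_le_add (le_max_right _ _) (le_max_right _ _)

theorem max_one_abs_sq_le (ht : 1 ≤ t) (htk : t ^ 2 = 1 + k ^ 2) :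
    max 1 |y| ^ 2 ≤ t ^ 2 * (max t |k + y| * max t |k - y|) := by
  have hsq : t ^ 2 ≤ max t |k + y| * max t |k - y| := by
    rw [sq]
    exact mul_le_mul (le_max_left _ _) (le_max_left _ _) (by linarith) (by positivity)
  have hdiff : y ^ 2 - k ^ 2 ≤ max t |k + y| * max t |k - y| :=
    calc y ^ 2 - k ^ 2 = -((k + y) * (k - y)) := by ring
      _ ≤ |k + y| * |k - y| := by rw [← abs_mul]; exact neg_le_abs _
      _ ≤ max t |k + y| * max t |k - y| := by gcongr <;> exact le_max_right _ _
  set mn := max t |k + y| * max t |k - y|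
  have hone : 1 ≤ t ^ 2 * mn := one_le_mul_of_one_le_of_one_le (one_le_pow₀ ht)
    ((one_le_pow₀ ht).trans hsq)
  rcases max_choice 1 |y| with h | h <;> rw [h]
  · rwa [one_pow]
  · rw [sq_abs]
    nlinarith [sq_nonneg k]

theorem two_mul_max_one_abs_rpow_le {p : ℝ} (hp : 0 ≤ p) (ht : 1 ≤ t) (htk : t ^ 2 = 1 + k ^ 2) :
    2 * max 1 |y| ^ p ≤ t * (max t |k + y| ^ p + max t |k - y| ^ p) := by
  have hm : 0 < max t |k + y| := lt_max_of_lt_left (by linarith)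
  have hn : 0 < max t |k - y| := lt_max_of_lt_left (by linarith)
  have hmn := max_one_abs_sq_le (y := y) ht htk
  have hadd := two_mul_max_one_abs_le (k := k) (y := y) ht
  have hY : 0 ≤ max 1 |y| := by positivity
  have ht0 : 0 ≤ t := by linarith
  generalize max t |k + y| = m at *
  generalize max t |k - y| = n at *
  generalize max 1 |y| = Y at *
  rcases le_total 1 p with hp1 | hp1
  · have hconv := (convexOn_rpow hp1).2 hm.le hn.le one_half_pos.le one_half_pos.le (add_halves 1)
    simp only [smul_eq_mul] at hconv
    calc 2 * Y ^ p ≤ 2 * (1 / 2 * m + 1 / 2 * n) ^ p := by gcongr; linarith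
      _ ≤ m ^ p + n ^ p := by linarith
      _ ≤ t * (m ^ p + n ^ p) := le_mul_of_one_le_left (by positivity) ht
  · have hsq {x : ℝ} (hx : 0 ≤ x) : x ^ p = (x ^ 2) ^ (p / 2) := by
      rw [← Real.rpow_two, ← Real.rpow_mul hx, mul_div_cancel₀ p two_ne_zero]
    have hsq' {x : ℝ} (hx : 0 ≤ x) : x ^ p = (x ^ (p / 2)) ^ 2 := by
      rw [← Real.rpow_two, ← Real.rpow_mul hx, div_mul_cancel₀ p two_ne_zero]
    calc 2 * Y ^ p ≤ 2 * (t ^ 2 * (m * n)) ^ (p / 2) := by rw [hsq hY]; gcongr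
      _ = t ^ p * (2 * m ^ (p / 2) * n ^ (p / 2)) := by
        rw [Real.mul_rpow (by positivity) (by positivity), Real.mul_rpow hm.le hn.le, ← hsq ht0]
        ring
      _ ≤ t * (m ^ p + n ^ p) := by
        rw [hsq' hm.le, hsq' hn.le]
        gcongr
        · exact Real.rpow_le_self_of_one_le ht hp1
        · exact two_mul_le_add_sq _ _

theorem two_mul_lineWeight_le {q : ℝ} (hq : 2 ≤ q) (ht : 1 ≤ t) (htk : t ^ 2 = 1 + k ^ 2) :
    2 * lineWeight q 1 0 y ≤ lineWeight q t k y + lineWeight q t k (-y) := by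
  have h := two_mul_max_one_abs_rpow_le (y := y) (sub_nonneg.2 hq) ht htk
  have : 0 ≤ t := by linarith
  simp only [lineWeight, neg_sq, ← sub_eq_add_neg, zero_add, one_mul]
  rw [← ENNReal.ofReal_ofNat, ← ENNReal.ofReal_mul zero_le_two,
    ← ENNReal.ofReal_add (by positivity) (by positivity), ← mul_add, ← mul_add, mul_left_comm]
  gcongr

end RightAngle

theorem lineEnergy_right_angle_le {q s c : ℝ} (hq : 2 ≤ q) (hs : 0 < s) (hsc : c ^ 2 + s ^ 2 = 1)
    (δ' δ : ℝ) : lineEnergy q 1 0 δ' δ ≤ lineEnergy q s c δ' δ := by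
  have ht : 1 ≤ s⁻¹ := (one_le_inv₀ hs).2 (by nlinarith [sq_nonneg c])
  have htk : s⁻¹ ^ 2 = 1 + (c / s) ^ 2 := by
    field_simp
    linarith
  have hmeas (t k : ℝ) : Measurable (lineWeight q t k) := by
    unfold lineWeight
    fun_prop
  rw [lineEnergy_eq one_pos (by norm_num), lineEnergy_eq hs hsc, inv_one, zero_div]
  gcongr ?_ * _
  refine (ENNReal.mul_le_mul_iff_right two_ne_zero ENNReal.ofNat_ne_top).1 ?_
  calc 2 * ∫⁻ y, lineWeight q 1 0 y
      = ∫⁻ y, 2 * lineWeight q 1 0 y := (lintegral_const_mul _ (hmeas 1 0)).symm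
    _ ≤ ∫⁻ y, (lineWeight q s⁻¹ (c / s) y + lineWeight q s⁻¹ (c / s) (-y)) :=
      lintegral_mono fun y => two_mul_lineWeight_le hq ht htk
    _ = 2 * ∫⁻ y, lineWeight q s⁻¹ (c / s) y := by
      rw [lintegral_add_left (hmeas _ _), lintegral_neg_eq_self, two_mul]

theorem volume_annulus {δ' δ : ℝ} (hδ' : 0 ≤ δ') (hδ : δ' ≤ δ) :
    volume (Metric.ball (0 : ℝ × ℝ) δ \ Metric.ball 0 δ') =
      ENNReal.ofReal (4 * (δ ^ 2 - δ' ^ 2)) := by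
  have hball {r : ℝ} (hr : 0 ≤ r) :
      volume (Metric.ball (0 : ℝ × ℝ) r) = ENNReal.ofReal (4 * r ^ 2) := by
    rw [← Prod.mk_zero_zero, ← ball_prod_same, Measure.volume_eq_prod, Measure.prod_prod,
      Real.volume_ball, ← ENNReal.ofReal_mul (by positivity)]
    congr 1
    ring
  rw [measure_sdiff (Metric.ball_subset_ball hδ) measurableSet_ball.nullMeasurableSet
    (by finiteness), hball (hδ'.trans hδ), hball hδ', ← ENNReal.ofReal_sub _ (by positivity),
    ← mul_sub]

theorem lineDensity_right_angle_le {q : ℝ} (hq : 0 ≤ q) {r : ℝ} (hr : 0 < r) {z : ℝ × ℝ}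
    (hz : r ≤ ‖z‖) : lineDensity q 1 0 z ≤ ENNReal.ofReal ((2 / r) ^ q) := by
  have hnorm : ‖z‖ ^ 2 ≤ z.1 ^ 2 + z.2 ^ 2 := by
    rw [Prod.norm_def, Real.norm_eq_abs, Real.norm_eq_abs, ← sq_abs z.1, ← sq_abs z.2]
    rcases max_choice |z.1| |z.2| with h | h <;> rw [h]
    exacts [le_add_of_nonneg_right (sq_nonneg _), le_add_of_nonneg_left (sq_nonneg _)]
  have hquot : 2 * |z.1| / (z.1 ^ 2 + z.2 ^ 2) ≤ 2 / r :=
    calc 2 * |z.1| / (z.1 ^ 2 + z.2 ^ 2) ≤ 2 * ‖z‖ / ‖z‖ ^ 2 := by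
          have hz0 : 0 < ‖z‖ := hr.trans_le hz
          gcongr
          exact norm_fst_le z
      _ = 2 / ‖z‖ := by field_simp
      _ ≤ 2 / r := by gcongr
  simp only [lineDensity, mul_one, mul_zero, sub_zero]
  gcongr

theorem lineEnergy_right_angle_le_ofReal {q : ℝ} (hq : 0 ≤ q) {r δ' δ : ℝ} (hr : 0 < r)
    (hδ' : r ≤ δ') (hδ : δ' ≤ δ) :
    lineEnergy q 1 0 δ' δ ≤ ENNReal.ofReal ((2 / r) ^ q * (4 * (δ ^ 2 - δ' ^ 2))) := by
  rw [ENNReal.ofReal_mul (by positivity), ← volume_annulus (hr.le.trans hδ') hδ,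
    ← setLIntegral_const]
  refine setLIntegral_mono (by fun_prop) fun z hz => lineDensity_right_angle_le hq hr ?_
  simpa using hδ'.trans (not_lt.1 (mt mem_ball_zero_iff.2 hz.2))

theorem tendsto_lineEnergy_right_angle {q : ℝ} (hq : 0 ≤ q) {δ : ℝ} (hδ : 0 < δ) :
    Tendsto (fun δ' => lineEnergy q 1 0 δ' δ) (𝓝[<] δ) (𝓝 0) := by
  have hlim : Tendsto (fun δ' => ENNReal.ofReal ((2 / (δ / 2)) ^ q * (4 * (δ ^ 2 - δ' ^ 2))))
      (𝓝[<] δ) (𝓝 0) := by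
    refine tendsto_nhdsWithin_of_tendsto_nhds
      ((ENNReal.continuous_ofReal.comp (by fun_prop)).tendsto' _ _ ?_)
    simp
  refine tendsto_of_tendsto_of_tendsto_of_le_of_le' tendsto_const_nhds hlim
    (Eventually.of_forall fun _ => bot_le) ?_
  filter_upwards [Ioo_mem_nhdsLT (half_lt_self hδ)] with δ' hδ'
  exact lineEnergy_right_angle_le_ofReal hq (half_pos hδ) hδ'.1.le hδ'.2.le

/-! ### Integrals over annuli in the torus -/

theorem setLIntegral_Ico_eq_of_periodic {g : ℝ → ℝ≥0∞} (hg : Function.Periodic g 1) (s t : ℝ) :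
    ∫⁻ x in Ico s (s + 1), g x = ∫⁻ x in Ico t (t + 1), g x := by
  rw [setLIntegral_congr (Ico_ae_eq_Ioc (a := s)), setLIntegral_congr (Ico_ae_eq_Ioc (a := t))]
  exact IsAddFundamentalDomain.setLIntegral_eq (isAddFundamentalDomain_Ioc one_pos s)
    (isAddFundamentalDomain_Ioc one_pos t) g hg.map_vadd_zmultiples

theorem setLIntegral_square_eq_of_periodic {F : ℝ × ℝ → ℝ≥0∞} (hF : Measurable F)
    (h1 : Function.Periodic F (1, 0)) (h2 : Function.Periodic F (0, 1)) (w w' : ℝ × ℝ) :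
    ∫⁻ z in Ico w.1 (w.1 + 1) ×ˢ Ico w.2 (w.2 + 1), F z =
      ∫⁻ z in Ico w'.1 (w'.1 + 1) ×ˢ Ico w'.2 (w'.2 + 1), F z := by
  have hfst (y : ℝ) : Function.Periodic (fun x => F (x, y)) 1 := fun x => by
    simpa only [Prod.mk_add_mk, add_zero] using h1 (x, y)
  have hsnd (x : ℝ) : Function.Periodic (fun y => F (x, y)) 1 := fun y => by
    simpa only [Prod.mk_add_mk, add_zero] using h2 (x, y)
  rw [Measure.volume_eq_prod, setLIntegral_prod _ hF.aemeasurable,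
    setLIntegral_prod _ hF.aemeasurable]
  simp only [setLIntegral_Ico_eq_of_periodic (hsnd _) w.2 w'.2]
  exact setLIntegral_Ico_eq_of_periodic (fun x => lintegral_congr fun y => hfst y x) _ _

theorem periodic_indicator_preimage_toTorus {F : ℝ × ℝ → ℝ≥0∞} {c : ℝ × ℝ}
    (hF : Function.Periodic F c) (hc : Function.Periodic toTorus c)
    (A : Set (UnitAddCircle × UnitAddCircle)) :
    Function.Periodic ((toTorus ⁻¹' A).indicator F) c := fun z => by
  have hmem : z + c ∈ toTorus ⁻¹' A ↔ z ∈ toTorus ⁻¹' A := by rw [mem_preimage, mem_preimage, hc z]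
  by_cases hz : z ∈ toTorus ⁻¹' A
  · rw [indicator_of_mem hz, indicator_of_mem (hmem.2 hz), hF z]
  · rw [indicator_of_notMem hz, indicator_of_notMem (mt hmem.1 hz)]

theorem dist_toTorus_add {z : ℝ × ℝ} (hz : ‖z‖ ≤ 1 / 2) (w : ℝ × ℝ) :
    dist (toTorus (w + z)) (toTorus w) = ‖z‖ := by
  have hcoe {x : ℝ} (hx : ‖x‖ ≤ 1 / 2) (u : ℝ) :
      dist ((u + x : ℝ) : UnitAddCircle) u = ‖x‖ := by
    rw [dist_eq_norm, AddCircle.coe_add, add_sub_cancel_left]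
    exact (AddCircle.norm_coe_eq_abs_iff (1 : ℝ) one_ne_zero).2 (by simpa using hx)
  rw [Prod.norm_def, ← hcoe ((norm_fst_le z).trans hz) w.1, ← hcoe ((norm_snd_le z).trans hz) w.2]
  rfl

theorem preimage_add_square_inter_annulus {δ' δ : ℝ} (hδ : δ ≤ 1 / 2) (w : ℝ × ℝ) :
    (w + ·) ⁻¹' (toTorus ⁻¹' (Metric.ball (toTorus w) δ \ Metric.ball (toTorus w) δ') ∩
        (Ico (w.1 - 1 / 2) (w.1 - 1 / 2 + 1) ×ˢ Ico (w.2 - 1 / 2) (w.2 - 1 / 2 + 1))) =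
      Metric.ball 0 δ \ Metric.ball 0 δ' := by
  ext z
  have hsquare : ‖z‖ ≤ 1 / 2 → (z ∈ (w + ·) ⁻¹'
      (toTorus ⁻¹' (Metric.ball (toTorus w) δ \ Metric.ball (toTorus w) δ')) ↔
        z ∈ Metric.ball 0 δ \ Metric.ball 0 δ') := fun hz => by
    simp only [mem_preimage, Set.mem_sdiff, Metric.mem_ball, dist_toTorus_add hz, dist_zero_right]
  constructor
  · rintro ⟨hz, ⟨h1, h2⟩, h3, h4⟩
    simp only [Prod.fst_add, Prod.snd_add] at h1 h2 h3 h4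
    refine (hsquare (norm_prod_le_iff.2 ⟨?_, ?_⟩)).1 hz <;> rw [Real.norm_eq_abs, abs_le] <;>
      constructor <;> linarith
  · intro hz
    have hlt : ‖z‖ < 1 / 2 := (mem_ball_zero_iff.1 hz.1).trans_le hδ
    obtain ⟨h1, h2⟩ := abs_lt.1 ((norm_fst_le z).trans_lt hlt)
    obtain ⟨h3, h4⟩ := abs_lt.1 ((norm_snd_le z).trans_lt hlt)
    refine ⟨(hsquare hlt.le).2 hz, ⟨?_, ?_⟩, ?_, ?_⟩ <;>
      simp only [Prod.fst_add, Prod.snd_add] <;> linarith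

theorem measurableSet_preimage_toTorus_annulus (P : UnitAddCircle × UnitAddCircle) (δ' δ : ℝ) :
    MeasurableSet (toTorus ⁻¹' (Metric.ball P δ \ Metric.ball P δ')) := by
  rw [preimage_sdiff]
  exact (Metric.isOpen_ball.preimage isOpenQuotientMap_toTorus.continuous).measurableSet.diff
    (Metric.isOpen_ball.preimage isOpenQuotientMap_toTorus.continuous).measurableSet

theorem setLIntegral_annulus_eq_of_periodic {F : ℝ × ℝ → ℝ≥0∞} (hF : Measurable F)
    (h1 : Function.Periodic F (1, 0)) (h2 : Function.Periodic F (0, 1)) {δ' δ : ℝ}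
    (hδ : δ ≤ 1 / 2) (w : ℝ × ℝ) :
    ∫⁻ z in (Ico (0 : ℝ) 1 ×ˢ Ico (0 : ℝ) 1) ∩
        toTorus ⁻¹' (Metric.ball (toTorus w) δ \ Metric.ball (toTorus w) δ'), F z =
      ∫⁻ z in Metric.ball 0 δ \ Metric.ball 0 δ', F (w + z) := by
  have hA := measurableSet_preimage_toTorus_annulus (toTorus w) δ' δ
  have hper1 : Function.Periodic toTorus (1, 0) := fun z =>
    Prod.ext (by simp [toTorus]) (by simp [toTorus])
  have hper2 : Function.Periodic toTorus (0, 1) := fun z =>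
    Prod.ext (by simp [toTorus]) (by simp [toTorus])
  have hshift := setLIntegral_square_eq_of_periodic (hF.indicator hA)
    (periodic_indicator_preimage_toTorus h1 hper1 _)
    (periodic_indicator_preimage_toTorus h2 hper2 _) 0 (w - (1 / 2, 1 / 2))
  rw [setLIntegral_indicator hA, setLIntegral_indicator hA] at hshift
  simp only [Prod.fst_zero, Prod.snd_zero, zero_add, Prod.fst_sub, Prod.snd_sub] at hshift
  rw [inter_comm, hshift, ← (measurePreserving_add_left volume w).setLIntegral_comp_preimage
    (hA.inter (measurableSet_Ico.prod measurableSet_Ico)) hF,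
    preimage_add_square_inter_annulus hδ]

theorem thickening_sdiff_thickening {X : Type*} [PseudoMetricSpace X] {Z : Set X} {δ' δ : ℝ}
    (hδ : δ' ≤ δ) (hdisj : Z.PairwiseDisjoint (Metric.ball · δ)) :
    Metric.thickening δ Z \ Metric.thickening δ' Z =
      ⋃ x ∈ Z, Metric.ball x δ \ Metric.ball x δ' := by
  simp only [Metric.thickening_eq_biUnion_ball]
  ext y
  simp only [Set.mem_sdiff, mem_iUnion, exists_prop, not_exists, not_and]
  constructor
  · rintro ⟨⟨x, hx, hy⟩, hnot⟩
    exact ⟨x, hx, hy, hnot x hx⟩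
  · rintro ⟨x, hx, hy, hy'⟩
    refine ⟨⟨x, hx, hy⟩, fun x' hx' hyx' => hy' ?_⟩
    rwa [hdisj.elim_set hx hx' y hy (Metric.ball_subset_ball hδ hyx')]

/-! ### Curves with straight crossings -/

/-- The conditions that define the class `F(η, j±, s, ω)`, apart from the prescribed values of the
invariants. -/
structure HasStraightCrossings (η : ℝ) (γ : ℝ → ℂ) : Prop extends IsGeneric γ where
  norm_deriv : ∀ t, ‖deriv γ t‖ = 1
  le_minArcDist : ENNReal.ofReal (2 * η) ≤ minArcDist γ
  affine : ∀ u ∈ intParams γ, ∃ p v : ℂ, ∀ x ∈ Ioo (u - η) (u + η), γ x = p + x • v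

theorem hasStraightCrossings_of_mem_admissible {η : ℝ} {jp jm s ω : ℤ} {γ : ℝ → ℂ}
    (hγ : γ ∈ admissible η jp jm s ω) : HasStraightCrossings η γ :=
  ⟨hγ.1.1, hγ.2.1, hγ.2.2.1, hγ.2.2.2⟩

theorem exists_mem_intParams_coe_eq {γ : ℝ → ℂ} (hγ : Function.Periodic γ 1)
    {P : UnitAddCircle × UnitAddCircle} (hP : P ∈ crossings γ) :
    (∃ a ∈ intParams γ, (a : UnitAddCircle) = P.1) ∧
      ∃ b ∈ intParams γ, (b : UnitAddCircle) = P.2 :=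
  forall_crossing_of_forall_selfInt hγ
    (R := fun P => (∃ a ∈ intParams γ, (a : UnitAddCircle) = P.1) ∧
      ∃ b ∈ intParams γ, (b : UnitAddCircle) = P.2)
    (fun _ => And.symm)
    (fun p hp => ⟨⟨p.1, ⟨p, hp, Or.inl rfl⟩, rfl⟩, ⟨p.2, ⟨p, hp, Or.inr rfl⟩, rfl⟩⟩) hP

theorem IsGeneric.coe_eq_or_coe_eq {γ : ℝ → ℂ} (hγ : IsGeneric γ) {z : ℝ × ℝ}
    (hz : toTorus z ∈ crossings γ) {t : ℝ} (ht : γ t = γ z.1) :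
    (t : UnitAddCircle) = z.1 ∨ (t : UnitAddCircle) = z.2 := by
  have hper := hγ.periodic
  have heq := ((toTorus_mem_crossings hper).1 hz).2
  refine forall_crossing_of_forall_selfInt hper
    (R := fun P => ∀ z, toTorus z = P → γ z.1 = γ z.2 → γ t = γ z.1 →
      (t : UnitAddCircle) = z.1 ∨ (t : UnitAddCircle) = z.2)
    (fun P hP z hz heq ht => (hP z.swap (congrArg Prod.swap hz) heq.symm (ht.trans heq)).symm)
    (fun p hp z hz _ ht => ?_) hz z rfl heq ht
  obtain ⟨h1, h2⟩ := Prod.ext_iff.1 hz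
  obtain ⟨t', ht', htt'⟩ := exists_mem_Ico_coe_eq t
  rw [← htt']
  refine (hγ.double p hp t' ht' ?_).imp (fun h => ?_) fun h => ?_
  · rw [apply_eq_of_coe_eq hper htt', ht, apply_eq_of_coe_eq hper h1]
  · rw [h]; exact h1.symm
  · rw [h]; exact h2.symm

theorem IsGeneric.injOn_fst_crossings {γ : ℝ → ℂ} (hγ : IsGeneric γ) :
    InjOn Prod.fst (crossings γ) := by
  intro P hP P' hP' h
  obtain ⟨z, rfl⟩ := isOpenQuotientMap_toTorus.surjective P
  obtain ⟨z', rfl⟩ := isOpenQuotientMap_toTorus.surjective P'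
  have heq' := ((toTorus_mem_crossings hγ.periodic).1 hP').2
  refine Prod.ext h (((hγ.coe_eq_or_coe_eq hP (t := z'.2) ?_).resolve_left fun h' => ?_).symm)
  · rw [← heq', apply_eq_of_coe_eq hγ.periodic h]
  · exact hP'.1 (h.symm.trans h'.symm)

namespace HasStraightCrossings

variable {η : ℝ} {γ : ℝ → ℂ}

theorem two_mul_le_dist (hγ : HasStraightCrossings η γ) {a b : ℝ} (ha : a ∈ intParams γ)
    (hb : b ∈ intParams γ) (hab : (a : UnitAddCircle) ≠ b) :
    2 * η ≤ dist (a : UnitAddCircle) b := by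
  rw [← arcDist_eq_dist hγ.norm_deriv, ← ENNReal.ofReal_le_ofReal_iff
    (arcDist_eq_dist hγ.norm_deriv a b ▸ dist_nonneg)]
  exact hγ.le_minArcDist.trans
    ((iInf₂_le a ha).trans ((iInf₂_le b hb).trans (iInf_le _ (ne_of_apply_ne _ hab))))

theorem pairwiseDisjoint_ball (hγ : HasStraightCrossings η γ) {δ : ℝ} (hδ : δ ≤ η) :
    (crossings γ).PairwiseDisjoint (Metric.ball · δ) := by
  intro P hP P' hP' hne
  obtain ⟨a, ha, haP⟩ := (exists_mem_intParams_coe_eq hγ.periodic hP).1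
  obtain ⟨b, hb, hbP'⟩ := (exists_mem_intParams_coe_eq hγ.periodic hP').1
  have hab := hγ.two_mul_le_dist ha hb fun h =>
    hne (hγ.injOn_fst_crossings hP hP' (haP.symm.trans (h.trans hbP')))
  rw [haP, hbP'] at hab
  refine Metric.ball_disjoint_ball ?_
  linarith [hab.trans (le_max_left (dist P.1 P'.1) (dist P.2 P'.2)),
    Prod.dist_eq (x := P) (y := P')]

theorem le_quarter (hγ : HasStraightCrossings η γ) (hne : (crossings γ).Nonempty) : η ≤ 1 / 4 := by
  obtain ⟨P, hP⟩ := hne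
  obtain ⟨⟨a, ha, haP⟩, b, hb, hbP⟩ := exists_mem_intParams_coe_eq hγ.periodic hP
  have hab : 2 * η ≤ dist (a : UnitAddCircle) b :=
    hγ.two_mul_le_dist ha hb fun h => hP.1 (haP.symm.trans (h.trans hbP))
  have hhalf := AddCircle.norm_le_half_period (1 : ℝ) (x := (a : UnitAddCircle) - b) one_ne_zero
  rw [← dist_eq_norm, abs_one] at hhalf
  linarith

theorem exists_affine_on_ball (hγ : HasStraightCrossings η γ) {z : ℝ × ℝ}
    (hz : toTorus z ∈ crossings γ) :
    ∃ p v : ℂ, ∀ x ∈ Metric.ball z.1 η, γ x = p + x • v := by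
  obtain ⟨u, hu, huz⟩ := (exists_mem_intParams_coe_eq hγ.periodic hz).1
  obtain ⟨p, v, haff⟩ := hγ.affine u hu
  refine ⟨p + (u - z.1) • v, v, fun x hx => ?_⟩
  rw [Real.ball_eq_Ioo] at hx
  have hcoe : (x : UnitAddCircle) = (x + (u - z.1) : ℝ) := by
    rw [AddCircle.coe_add, AddCircle.coe_sub, huz]
    simp [toTorus]
  rw [apply_eq_of_coe_eq hγ.periodic hcoe, haff _ ⟨by linarith [hx.1], by linarith [hx.2]⟩,
    add_smul, add_assoc, add_comm (x • v)]

theorem apply_fst_add (hγ : HasStraightCrossings η γ) {z : ℝ × ℝ} (hz : toTorus z ∈ crossings γ)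
    {x : ℝ} (hx : |x| < η) :
    γ (z.1 + x) = γ z.1 + x • deriv γ z.1 ∧ deriv γ (z.1 + x) = deriv γ z.1 := by
  obtain ⟨p, v, haff⟩ := hγ.exists_affine_on_ball hz
  have hderiv {t : ℝ} (ht : t ∈ Metric.ball z.1 η) : deriv γ t = v := by
    rw [(eventuallyEq_of_mem (Metric.isOpen_ball.mem_nhds ht) haff).deriv_eq]
    simpa only [one_smul, id] using (((hasDerivAt_id t).smul_const v).const_add p).deriv
  have hz : z.1 ∈ Metric.ball z.1 η := Metric.mem_ball_self ((abs_nonneg x).trans_lt hx)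
  have hzx : z.1 + x ∈ Metric.ball z.1 η := by simpa using hx
  rw [hderiv hzx, hderiv hz, haff _ hzx, haff _ hz, add_smul, add_assoc]
  exact ⟨rfl, rfl⟩

theorem tpDensity_add (hγ : HasStraightCrossings η γ) (q : ℝ) {z : ℝ × ℝ}
    (hz : toTorus z ∈ crossings γ) {x : ℝ × ℝ} (hx : ‖x‖ < η) :
    tpDensity q γ (z + x) = lineDensity q |cross (deriv γ z.1) (deriv γ z.2)|
      (inner ℝ (deriv γ z.1) (deriv γ z.2)) x := by
  obtain ⟨h1, h1'⟩ := hγ.apply_fst_add hz ((norm_fst_le x).trans_lt hx)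
  obtain ⟨h2, h2'⟩ := hγ.apply_fst_add (z := z.swap) (swap_mem_crossings hz)
    ((norm_snd_le x).trans_lt hx)
  rw [Prod.fst_swap] at h2 h2'
  have heq := ((toTorus_mem_crossings hγ.periodic).1 hz).2
  have hn1 := hγ.norm_deriv z.1
  have hn2 := hγ.norm_deriv z.2
  simp only [tpDensity, lineDensity, Prod.fst_add, Prod.snd_add, h1, h2, h2', heq]
  set v := deriv γ z.1
  set w := deriv γ z.2
  have hcross : |cross w (x.1 • v - x.2 • w)| = |x.1| * |cross v w| := by
    rw [map_sub, map_smul, map_smul, Orientation.areaForm_apply_self, smul_zero, sub_zero,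
      smul_eq_mul, abs_mul, Orientation.areaForm_swap, abs_neg]
  have hnorm : ‖x.2 • w - x.1 • v‖ ^ 2 = x.1 ^ 2 + x.2 ^ 2 - 2 * (x.1 * x.2 * inner ℝ v w) := by
    rw [norm_sub_sq_real, norm_smul, norm_smul, hn1, hn2, real_inner_smul_left,
      real_inner_smul_right, real_inner_comm, mul_one, mul_one, Real.norm_eq_abs, Real.norm_eq_abs,
      sq_abs, sq_abs]
    ring
  rw [add_sub_add_left_eq_sub, add_sub_add_left_eq_sub, hcross, hnorm]

end HasStraightCrossings

/-! ### The energy near the crossings -/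

/-- The part of the energy that comes from the annulus with radii `δ'` and `δ` around the point `P`
of the torus. -/
def crossingEnergy (q δ' δ : ℝ) (γ : ℝ → ℂ) (P : UnitAddCircle × UnitAddCircle) : ℝ≥0∞ :=
  ∫⁻ z in (Ico (0 : ℝ) 1 ×ˢ Ico (0 : ℝ) 1) ∩ toTorus ⁻¹' (Metric.ball P δ \ Metric.ball P δ'),
    tpDensity q γ z

theorem areaForm_ne_zero_of_linearIndependent {E : Type*} [NormedAddCommGroup E]
    [InnerProductSpace ℝ E] [Fact (Module.finrank ℝ E = 2)] (o : Orientation ℝ E (Fin 2)) {v w : E}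
    (h : LinearIndependent ℝ ![v, w]) : o.areaForm v w ≠ 0 := by
  intro h0
  have hv : v ≠ 0 := h.ne_zero 0
  have hinner := o.inner_sq_add_areaForm_sq v w
  rw [h0, zero_pow two_ne_zero, add_zero, ← mul_pow, ← sq_abs,
    pow_left_inj₀ (abs_nonneg _) (by positivity) two_ne_zero] at hinner
  obtain ⟨r, -, rfl⟩ := (norm_inner_eq_norm_iff (𝕜 := ℝ) hv (h.ne_zero 1)).1 hinner
  exact (LinearIndependent.pair_iff' hv).1 h r rfl

theorem tsum_const_eq_ncard_mul {X : Type*} {Z : Set X} (hZ : Z.Finite) (c : ℝ≥0∞) :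
    ∑' _ : Z, c = Z.ncard * c := by
  rw [ENNReal.tsum_set_const, ← hZ.cast_ncard_eq]
  rfl

namespace HasStraightCrossings

variable {η : ℝ} {γ : ℝ → ℂ}

theorem truncEnergy_eq_add_tsum (hγ : HasStraightCrossings η γ) (q : ℝ) {δ' δ : ℝ} (hδ' : δ' ≤ δ)
    (hδ : δ ≤ η) :
    truncEnergy q δ' γ = truncEnergy q δ γ + ∑' P : crossings γ, crossingEnergy q δ' δ γ P := by
  have hdisj := hγ.pairwiseDisjoint_ball hδ
  have htrunc := truncSet_eq_preimage_thickening hγ.periodic hγ.norm_deriv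
  set Q : Set (ℝ × ℝ) := Ico (0 : ℝ) 1 ×ˢ Ico (0 : ℝ) 1
  have hinner : (Q \ truncSet γ δ') ∩ truncSet γ δ =
      ⋃ P ∈ crossings γ, Q ∩ toTorus ⁻¹' (Metric.ball P δ \ Metric.ball P δ') := by
    rw [← inter_iUnion₂, ← preimage_iUnion₂, ← thickening_sdiff_thickening hδ' hdisj,
      preimage_sdiff, ← htrunc, ← htrunc, inter_comm, inter_sdiff_left_comm, inter_comm]
  have houter : (Q \ truncSet γ δ') \ truncSet γ δ = Q \ truncSet γ δ := by
    have hsub : truncSet γ δ' ⊆ truncSet γ δ := by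
      rw [htrunc, htrunc]
      exact preimage_mono (Metric.thickening_mono hδ' _)
    rw [sdiff_sdiff, union_eq_self_of_subset_left hsub]
  rw [truncEnergy_eq hγ.norm_deriv, truncEnergy_eq hγ.norm_deriv,
    ← lintegral_inter_add_sdiff _ _ (isOpen_truncSet hγ.periodic hγ.norm_deriv δ).measurableSet,
    houter, hinner, add_comm]
  congr 1
  refine lintegral_biUnion (finite_crossings hγ.periodic hγ.finite).countable
    (fun P _ => (measurableSet_Ico.prod measurableSet_Ico).inter
      (measurableSet_preimage_toTorus_annulus P δ' δ)) (fun P hP P' hP' hne => ?_) _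
  exact ((hdisj hP hP' hne).preimage toTorus).mono
    (inter_subset_right.trans (preimage_mono sdiff_subset))
    (inter_subset_right.trans (preimage_mono sdiff_subset))

theorem crossingEnergy_toTorus (hγ : HasStraightCrossings η γ) (q δ' : ℝ) {δ : ℝ} (hδ : δ ≤ η)
    {z : ℝ × ℝ} (hz : toTorus z ∈ crossings γ) :
    crossingEnergy q δ' δ γ (toTorus z) = lineEnergy q |cross (deriv γ z.1) (deriv γ z.2)|
      (inner ℝ (deriv γ z.1) (deriv γ z.2)) δ' δ := by
  have hdper := periodic_deriv hγ.periodic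
  have hη := hγ.le_quarter ⟨_, hz⟩
  rw [crossingEnergy, setLIntegral_annulus_eq_of_periodic
    (measurable_tpDensity hγ.contDiff.continuous q) (fun x => ?_) (fun x => ?_) (by linarith)]
  · exact setLIntegral_congr_fun (measurableSet_ball.diff measurableSet_ball)
      fun x hx => hγ.tpDensity_add q hz ((mem_ball_zero_iff.1 hx.1).trans_le hδ)
  · simp only [tpDensity, Prod.fst_add, Prod.snd_add, add_zero, hγ.periodic x.1]
  · simp only [tpDensity, Prod.fst_add, Prod.snd_add, add_zero, hγ.periodic x.2, hdper x.2]

theorem inner_sq_add_abs_cross_sq (hγ : HasStraightCrossings η γ) (z : ℝ × ℝ) :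
    inner ℝ (deriv γ z.1) (deriv γ z.2) ^ 2 + |cross (deriv γ z.1) (deriv γ z.2)| ^ 2 = 1 := by
  rw [sq_abs, Orientation.inner_sq_add_areaForm_sq, hγ.norm_deriv, hγ.norm_deriv, one_pow, one_mul]

theorem abs_cross_deriv_pos (hγ : HasStraightCrossings η γ) {z : ℝ × ℝ}
    (hz : toTorus z ∈ crossings γ) : 0 < |cross (deriv γ z.1) (deriv γ z.2)| :=
  abs_pos.2 (areaForm_ne_zero_of_linearIndependent _ (hγ.linearIndependent_deriv hz))

theorem lineEnergy_right_angle_le_crossingEnergy (hγ : HasStraightCrossings η γ) {q : ℝ}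
    (hq : 2 ≤ q) (δ' : ℝ) {δ : ℝ} (hδ : δ ≤ η) {P : UnitAddCircle × UnitAddCircle}
    (hP : P ∈ crossings γ) : lineEnergy q 1 0 δ' δ ≤ crossingEnergy q δ' δ γ P := by
  obtain ⟨z, rfl⟩ := isOpenQuotientMap_toTorus.surjective P
  rw [hγ.crossingEnergy_toTorus q δ' hδ hP]
  exact lineEnergy_right_angle_le hq (hγ.abs_cross_deriv_pos hP) (hγ.inner_sq_add_abs_cross_sq z)
    δ' δ

theorem inner_deriv_eq_zero (hγ : HasStraightCrossings η γ)
    (hangle : ∀ p ∈ selfInt γ, intersectionAngle γ p = Real.pi / 2) {z : ℝ × ℝ}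
    (hz : toTorus z ∈ crossings γ) : inner ℝ (deriv γ z.1) (deriv γ z.2) = 0 := by
  have hdper := periodic_deriv hγ.periodic
  refine forall_crossing_of_forall_selfInt hγ.periodic
    (R := fun P => ∀ z, toTorus z = P → inner ℝ (deriv γ z.1) (deriv γ z.2) = 0)
    (fun P hP z hz => by rw [real_inner_comm]; exact hP z.swap (congrArg Prod.swap hz))
    (fun p hp z hz => ?_) hz z rfl
  obtain ⟨h1, h2⟩ := Prod.ext_iff.1 hz
  rw [apply_eq_of_coe_eq hdper h1, apply_eq_of_coe_eq hdper h2,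
    InnerProductGeometry.inner_eq_zero_iff_angle_eq_pi_div_two]
  have hp := hangle p hp
  rw [intersectionAngle] at hp
  apply le_antisymm
  · linarith [min_le_right (InnerProductGeometry.angle (deriv γ p.1) (deriv γ p.2))
      (Real.pi - InnerProductGeometry.angle (deriv γ p.1) (deriv γ p.2))]
  · exact hp.symm.trans_le (min_le_left _ _)

theorem crossingEnergy_eq_of_right_angles (hγ : HasStraightCrossings η γ) (q δ' : ℝ) {δ : ℝ}
    (hδ : δ ≤ η) (hangle : ∀ p ∈ selfInt γ, intersectionAngle γ p = Real.pi / 2)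
    {P : UnitAddCircle × UnitAddCircle} (hP : P ∈ crossings γ) :
    crossingEnergy q δ' δ γ P = lineEnergy q 1 0 δ' δ := by
  obtain ⟨z, rfl⟩ := isOpenQuotientMap_toTorus.surjective P
  have hinner := hγ.inner_deriv_eq_zero hangle hP
  rw [hγ.crossingEnergy_toTorus q δ' hδ hP, hinner, Orientation.abs_areaForm_of_orthogonal _ hinner,
    hγ.norm_deriv, hγ.norm_deriv, mul_one]

theorem add_le_truncEnergy (hγ : HasStraightCrossings η γ) {q : ℝ} (hq : 2 ≤ q) {δ' δ : ℝ}
    (hδ' : δ' ≤ δ) (hδ : δ ≤ η) :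
    truncEnergy q δ γ + (crossings γ).ncard * lineEnergy q 1 0 δ' δ ≤ truncEnergy q δ' γ := by
  rw [hγ.truncEnergy_eq_add_tsum q hδ' hδ,
    ← tsum_const_eq_ncard_mul (finite_crossings hγ.periodic hγ.finite)]
  gcongr with P
  exact hγ.lineEnergy_right_angle_le_crossingEnergy hq δ' hδ P.2

theorem truncEnergy_eq_of_right_angles (hγ : HasStraightCrossings η γ) (q : ℝ) {δ' δ : ℝ}
    (hδ' : δ' ≤ δ) (hδ : δ ≤ η)
    (hangle : ∀ p ∈ selfInt γ, intersectionAngle γ p = Real.pi / 2) :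
    truncEnergy q δ' γ = truncEnergy q δ γ + (crossings γ).ncard * lineEnergy q 1 0 δ' δ := by
  rw [hγ.truncEnergy_eq_add_tsum q hδ' hδ,
    ← tsum_const_eq_ncard_mul (finite_crossings hγ.periodic hγ.finite)]
  congr 1
  exact tsum_congr fun P => hγ.crossingEnergy_eq_of_right_angles q δ' hδ hangle P.2

end HasStraightCrossings

/-! ### Minimizers -/

theorem truncEnergy_le_of_isEnergyMinimizer {q η δ' δ : ℝ} (hq : 2 ≤ q) {A : Set (ℝ → ℂ)}
    (hA : ∀ β ∈ A, HasStraightCrossings η β) (hδ'₀ : 0 < δ') (hδ' : δ' ≤ δ) (hδ : δ ≤ η)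
    {β γ : ℝ → ℂ} (hβ : IsEnergyMinimizer q δ' A β) (hγ : γ ∈ A)
    (hcard : (crossings γ).ncard ≤ (crossings β).ncard)
    (hangle : ∀ p ∈ selfInt γ, intersectionAngle γ p = Real.pi / 2) :
    truncEnergy q δ β ≤ truncEnergy q δ γ := by
  set L := lineEnergy q 1 0 δ' δ
  have hL : L ≠ ∞ := ne_top_of_le_ne_top ENNReal.ofReal_ne_top
    (lineEnergy_right_angle_le_ofReal (by linarith) hδ'₀ le_rfl hδ')
  have h : truncEnergy q δ β + (crossings γ).ncard * L ≤
      truncEnergy q δ γ + (crossings γ).ncard * L :=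
    calc truncEnergy q δ β + (crossings γ).ncard * L
      _ ≤ truncEnergy q δ β + (crossings β).ncard * L := by gcongr
      _ ≤ truncEnergy q δ' β := (hA β hβ.1).add_le_truncEnergy hq hδ' hδ
      _ ≤ truncEnergy q δ' γ := hβ.2 γ hγ
      _ = truncEnergy q δ γ + (crossings γ).ncard * L :=
        (hA γ hγ).truncEnergy_eq_of_right_angles q hδ' hδ hangle
  exact (ENNReal.add_le_add_iff_right (ENNReal.mul_ne_top (ENNReal.natCast_ne_top _) hL)).1 h

theorem HasStraightCrossings.tendsto_truncEnergy {q η δ : ℝ} (hq : 0 ≤ q) {γ : ℝ → ℂ}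
    (hγ : HasStraightCrossings η γ) (hδ : δ ∈ Ioc 0 η)
    (hangle : ∀ p ∈ selfInt γ, intersectionAngle γ p = Real.pi / 2) :
    Tendsto (fun δ' => truncEnergy q δ' γ) (𝓝[<] δ) (𝓝 (truncEnergy q δ γ)) := by
  have h := (ENNReal.Tendsto.const_mul (tendsto_lineEnergy_right_angle hq hδ.1)
    (Or.inr (ENNReal.natCast_ne_top (crossings γ).ncard))).const_add (truncEnergy q δ γ)
  rw [mul_zero, add_zero] at h
  refine h.congr' ?_
  filter_upwards [self_mem_nhdsWithin] with δ' hδ'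
  exact (hγ.truncEnergy_eq_of_right_angles q (le_of_lt hδ') hδ.2 hangle).symm

end PlaneCurve

end

open PlaneCurve in
theorem corollary1p6_general {q η : ℝ} (hq : 2 ≤ q) {A : Set (ℝ → ℂ)}
    (hA : ∀ β ∈ A, HasStraightCrossings η β) {δs : ℕ → ℝ} (hδs : ∀ k, 0 < δs k)
    (hlim : Tendsto δs atTop (𝓝 0)) {γs : ℕ → ℝ → ℂ}
    (hmin : ∀ k, IsEnergyMinimizer q (δs k) A (γs k)) {a : ℕ → ℂ} {Γ : ℝ → ℂ}
    (hΓ : TendstoC1 (fun k t => γs k t + a k) Γ) {δ : ℝ} (hδ : δ ∈ Ioc 0 η) {γ : ℝ → ℂ}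
    (hγ : γ ∈ A) (hcard : ∀ β ∈ A, (crossings γ).ncard ≤ (crossings β).ncard)
    (hangle : ∀ p ∈ selfInt γ, intersectionAngle γ p = Real.pi / 2) :
    truncEnergy q δ Γ ≤ truncEnergy q δ γ := by
  have hq0 : 0 < q := by linarith
  have hγs (k : ℕ) := hA _ (hmin k).1
  refine ge_of_tendsto ((hA γ hγ).tendsto_truncEnergy hq0.le hδ hangle) ?_
  filter_upwards [Ioo_mem_nhdsLT hδ.1] with δ' hδ'
  have hminimal : ∀ᶠ k in atTop, truncEnergy q δ' (γs k) ≤ truncEnergy q δ' γ := by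
    filter_upwards [hlim.eventually (gt_mem_nhds hδ'.1)] with k hk
    exact truncEnergy_le_of_isEnergyMinimizer hq hA (hδs k) hk.le (hδ'.2.le.trans hδ.2) (hmin k) hγ
      (hcard _ (hmin k).1) hangle
  calc truncEnergy q δ Γ
    _ ≤ liminf (fun k => truncEnergy q δ' fun t => γs k t + a k) atTop :=
      hΓ.truncEnergy_le_liminf hq0 hδ'.2
        (fun k => ⟨fun t => by rw [(hγs k).periodic t], (hγs k).contDiff.add contDiff_const⟩)
        fun k t => by rw [deriv_add_const, (hγs k).norm_deriv]
    _ = liminf (fun k => truncEnergy q δ' (γs k)) atTop := by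
      simp only [truncEnergy_add_const (hγs _).norm_deriv]
    _ ≤ liminf (fun _ : ℕ => truncEnergy q δ' γ) atTop := liminf_le_liminf hminimal
    _ = truncEnergy q δ' γ := liminf_const _

theorem corollary1p6 (jp jm s ω : ℤ) (C : Set (ℝ → ℂ))
    (hC : PlaneCurve.IsCompartment jp jm s ω C)
    (q : ℝ) (hq : 2 < q) (η : ℝ) (hη : η ∈ Set.Ioo (0 : ℝ) 1)
    -- truncation parameters tending to zero, with corresponding minimizers
    (δs : ℕ → ℝ) (hδs : ∀ k, δs k ∈ Set.Ioc 0 (η / 2))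
    (hlim : Filter.Tendsto δs Filter.atTop (nhds 0))
    (γs : ℕ → ℝ → ℂ)
    (hmin : ∀ k, PlaneCurve.IsEnergyMinimizer q (δs k)
      (PlaneCurve.admissible η jp jm s ω ∩ C) (γs k))
    -- the limit curve, after suitable translations
    (a : ℕ → ℂ) (Γ : ℝ → ℂ)
    (hΓ : PlaneCurve.TendstoC1 (fun k t => γs k t + a k) Γ) :
    ∀ δ ∈ Set.Ioc 0 (η / 2), ∀ γ ∈ PlaneCurve.admissible η jp jm s ω ∩ C,
      (∀ p ∈ PlaneCurve.selfInt γ, PlaneCurve.intersectionAngle γ p = Real.pi / 2) →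
      PlaneCurve.truncEnergy q δ Γ ≤ PlaneCurve.truncEnergy q δ γ :=
  fun _ hδ γ hγ hangle => corollary1p6_general hq.le
    (fun _ hβ => PlaneCurve.hasStraightCrossings_of_mem_admissible hβ.1) (fun k => (hδs k).1) hlim
    hmin hΓ ⟨hδ.1, by linarith [hδ.2, hη.1]⟩ hγ
    (fun _ hβ => (hC.ncard_crossings_eq hγ.2 hβ.2).le) hangle
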